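/- Let $\mathscr A=\{1,\dots,k\}$ be a finite alphabet with a partition $\mathscr A=\mathscr A_{\mathrm{sing}}\sqcup\mathscr A_{\mathrm{inv}}$ into two nonempty sets, and let $$\mathcal M=\{\underline A=(A_1,\dots,A_k)\in \mathrm{Mat}_2(\mathbb R)^k:\ \operatorname{rank}A_i=1\ \ \forall i\in\mathscr A_{\mathrm{sing}},\ \ \det A_j>0\ \ \forall j\in\mathscr A_{\mathrm{inv}}\},$$ an analytic submanifold of $\mathrm{Mat}_2(\mathbb R)^k$ of dimension $3\,\#\mathscr A_{\mathrm{sing}}+4\,\#\mathscr A_{\mathrm{inv}}$, equipped with its Lebesgue measure. On $X=\mathscr A^{\mathbb Z}$ let $\mu$ be either the Bernoulli measure $p^{\mathbb Z}$ of a probability vector $p$ with $p_i>0$ for all $i$, or the Markov measure determined by a primitive left stochastic matrix $P=(p_{ij})$ (that is, $p_{ij}\ge 0$, $\sum_i p_{ij}=1$ for all $j$, and some power of $P$ has only positive entries) and its stationary probability vector $q=Pq$; here $p_{ij}$ is the probability of passing from $j$ to $i$, so that $\mu\{\omega:\omega_m=i_0,\dots,\omega_{m+n}=i_n\}=q_{i_0}p_{i_1i_0}\cdots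 p_{i_ni_{n-1}}$. For $\omega\in X$ put $A^n(\omega)=A_{\omega_n}\cdots A_{\omega_2}A_{\omega_1}$, let $\|\cdot\|$ be the operator norm for the Euclidean norm of $\mathbb R^2$, let $\log 0=-\infty$, and let $L_1(\underline A)\in[-\infty,\infty)$ be the $\mu$-almost everywhere limit of $\frac1n\log\|A^n(\omega)\|$. Then there is a constant $c>0$, which depends only on the partition and on $\mu$, such that with $c_0(\varepsilon)=c\,\min\{1,\varepsilon^2\}$ the following holds for Lebesgue almost every $\underline A\in\mathcal M$: $L_1(\underline A)>-\infty$, and there is a constant $C<\infty$ (depending on $\underline A$, but not on $\varepsilon$ or $n$) such that for every $\varepsilon>0$ and every $n\ge 1$ $$\mu\Big\{\omega\in X:\ \Big|\tfrac1n\log\|A^n(\omega)\|-L_1(\underline A)\Big|>\varepsilon\Big\}\le C\,e^{-c_0(\varepsilon)\,n^{1/3}}.$$ -/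

import Mathlib

open Set Filter Topology MeasureTheory
open scoped ENNReal Matrix.Norms.L2Operator

noncomputable section

namespace RandomCocycle

/-- Real `2 × 2` matrices, normed by the operator norm associated with the Euclidean norm of `ℝ²`
(the largest singular value). -/
abbrev Mat2 : Type := Matrix (Fin 2) (Fin 2) ℝ

/-- The Borel σ-algebra on `2 × 2` matrices (generated by the entries). -/
instance instMeasurableSpaceMat2 : MeasurableSpace Mat2 :=
  inferInstanceAs (MeasurableSpace (Fin 2 → Fin 2 → ℝ))

instance instBorelSpaceMat2 : BorelSpace Mat2 :=
  inferInstanceAs (BorelSpace (Fin 2 → Fin 2 → ℝ))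

instance instSecondCountableMat2 : SecondCountableTopology Mat2 :=
  inferInstanceAs (SecondCountableTopology (Fin 2 → Fin 2 → ℝ))

/-! ### The base dynamics on `X = 𝒜^ℤ`, with the alphabet `𝒜 = Fin k` -/

/-- `μ` is the Bernoulli measure `p^ℤ` of a probability vector `p` with positive entries. -/
def IsBernoulliMeasure {k : ℕ} (μ : Measure (ℤ → Fin k)) : Prop :=
  ∃ p : PMF (Fin k), (∀ i, p i ≠ 0) ∧ μ = Measure.infinitePi fun _ : ℤ => p.toMeasure

/-- `μ` is the law of the stationary Markov chain indexed by `ℤ` with (left stochastic) transition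
matrix `P`, where `P i j` is the probability of passing from `j` to `i`, and with marginal `q`:
the cylinder `{ω | ω_m = w_0, …, ω_{m+n} = w_n}` has measure
`q_{w_0} P_{w_1 w_0} ⋯ P_{w_n w_{n-1}}`. As the cylinders form a generating π-system,
this determines `μ`. -/
def IsMarkovLaw {k : ℕ} (P : Matrix (Fin k) (Fin k) ℝ) (q : Fin k → ℝ)
    (μ : Measure (ℤ → Fin k)) : Prop :=
  IsProbabilityMeasure μ ∧
    ∀ (m : ℤ) (n : ℕ) (w : Fin (n + 1) → Fin k),
      μ {ω | ∀ l : Fin (n + 1), ω (m + (l : ℕ)) = w l} =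
        ENNReal.ofReal (q (w 0) * ∏ l : Fin n, P (w l.succ) (w l.castSucc))

/-- `μ` is the measure of a mixing Markov shift: the Markov measure given by a primitive left
stochastic matrix `P` and a `P`-stationary probability vector `q`. -/
def IsMixingMarkovMeasure {k : ℕ} (μ : Measure (ℤ → Fin k)) : Prop :=
  ∃ (P : Matrix (Fin k) (Fin k) ℝ) (q : Fin k → ℝ),
    P ∈ Matrix.colStochastic ℝ (Fin k) ∧ P.IsPrimitive ∧
    q ∈ stdSimplex ℝ (Fin k) ∧ P.mulVec q = q ∧ IsMarkovLaw P q μ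

/-! ### The manifold of cocycles and its Lebesgue measure -/

/-- The cocycles `A = (A_i)` with `rank A_i = 1` for `i ∈ sing` and `det A_j > 0` for `j ∉ sing`. -/
def cocycleManifold {k : ℕ} (sing : Finset (Fin k)) : Set (Fin k → Mat2) :=
  {A | (∀ i ∈ sing, (A i).rank = 1) ∧ ∀ j ∉ sing, 0 < (A j).det}

/-- The dimension of `cocycleManifold sing`: the rank one `2 × 2` matrices form a hypersurface of
dimension `3`, the matrices with positive determinant an open set of dimension `4`. -/
def cocycleDim {k : ℕ} (sing : Finset (Fin k)) : ℕ :=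
  3 * sing.card + 4 * singᶜ.card

/-- Lebesgue measure on the embedded submanifold `cocycleManifold sing` of the vector space of all
tuples of matrices: the Hausdorff measure of the dimension of the submanifold, restricted to it.
Charts being locally bi-Lipschitz, its null sets are the sets which are Lebesgue null in charts. -/
def lebesgueCocycle {k : ℕ} (sing : Finset (Fin k)) : Measure (Fin k → Mat2) :=
  (Measure.hausdorffMeasure (cocycleDim sing : ℝ)).restrict (cocycleManifold sing)

/-! ### Iterates and the Lyapunov exponent -/

/-- The fiber iterates `A^n(ω) = A_{ω_n} ⋯ A_{ω_2} A_{ω_1}`, with `A^0(ω) = 1`. -/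
def iter {k : ℕ} (A : Fin k → Mat2) (ω : ℤ → Fin k) : ℕ → Mat2
  | 0 => 1
  | n + 1 => A (ω ((n : ℤ) + 1)) * iter A ω n

/-- `(1/n) log ‖A^n(ω)‖ ∈ [-∞, ∞)`, where `log 0 = -∞`. -/
def growthRate {k : ℕ} (A : Fin k → Mat2) (n : ℕ) (ω : ℤ → Fin k) : EReal :=
  ENNReal.log ‖iter A ω n‖ₑ / (n : EReal)

/-- `L` is the first Lyapunov exponent of `A` over the base measure `μ`: it is the limit of
`(1/n) log ‖A^n(ω)‖` for `μ`-almost every `ω`. -/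
def IsFirstLyapunovExponent {k : ℕ} (μ : Measure (ℤ → Fin k)) (A : Fin k → Mat2)
    (L : EReal) : Prop :=
  ∀ᵐ ω ∂μ, Tendsto (fun n : ℕ => growthRate A n ω) atTop (𝓝 L)

/-- The event `|(1/n) log ‖A^n(ω)‖ - L| > ε` (it contains every `ω` with `A^n(ω) = 0`). -/
def deviationEvent {k : ℕ} (A : Fin k → Mat2) (L : ℝ) (ε : ℝ) (n : ℕ) : Set (ℤ → Fin k) :=
  {ω | ENNReal.ofReal ε < (growthRate A n ω - (L : EReal)).abs}

end RandomCocycle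

end

/-!
Two facts carry the proof.

*Almost every cocycle is nondegenerate* (`ae_exists_isNondegenerate`). A rank one matrix is
`A_i = v_i u_iᵀ`, so a block of invertible matrices `A_w` between two rank one matrices `A_i` and
`A_j` acts as the scalar `u_jᵀ A_w v_i`. In a chart with `u_j = (1, t)` this is an affine function
of `t` whose coefficients decay at most exponentially in the length of `w`. As there are only
exponentially many words of a given length, the Borel–Cantelli lemma shows that for almost every
`t` all these scalars are at least `exp (-K (|w| + 1))`. By Fubini's theorem in the charts, which
are locally Lipschitz, this holds for almost every cocycle.

*Deviations for a nondegenerate cocycle* (`IsNondegenerate.exists_lyapunov`). The function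
`X w = log ‖A_w‖` of words is subadditive and of linear size. Conversely, cutting a word into two
loses at most a multiple of the distances from the cut to the nearest rank one factors, so `X`
lies above a superadditive function `Y` (`lowerLogNorm`) whose difference to `X` is controlled by
the lengths of the runs of invertible letters at the two ends of the word. The mean of these
lengths is bounded, and hence the means of `X` and of `Y` are `n L + O(1)`, uniformly in the letter
from which the Markov chain starts (`exists_linear_mean`). The exponential moments of the
subadditive functions `X` and `-Y`, maximized over the starting letter, are submultiplicative.
Chernoff's bound with blocks of length about `√n` therefore gives `exp (-a min(1, ε²) √n)`, where
`a > 0` depends on the cocycle. Since `√n` outgrows `n ^ (1/3)`, any constant `c` is admissible in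
the rate `c min(1, ε²) n ^ (1/3)`, at the expense of the prefactor; `c = 1` is used. The almost
sure convergence to `L` follows from this bound by the Borel–Cantelli lemma.
-/

noncomputable section

namespace RandomCocycle

/-! ### Expectations over the words of a Markov chain -/

section WordExp

variable {α : Type*} [Fintype α]

/-- The expectation of `f (ω₁ ⋯ ωₙ)`, where `a, ω₁, …, ωₙ` is the Markov chain with (left
stochastic) transition matrix `P` started at the letter `a`. -/
def wordExp (P : Matrix α α ℝ) : ℕ → (List α → ℝ) → α → ℝ
  | 0, f, _ => f []
  | n + 1, f, a => ∑ b, P b a * wordExp P n (fun w => f (b :: w)) b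

variable {P : Matrix α α ℝ}

lemma wordExp_congr {n : ℕ} {f g : List α → ℝ} {a : α} (h : ∀ w, w.length = n → f w = g w) :
    wordExp P n f a = wordExp P n g a := by
  induction n generalizing f g a with
  | zero => exact h [] rfl
  | succ n ih =>
    refine Finset.sum_congr rfl fun b _ => ?_
    rw [ih fun w hw => h (b :: w) (by simp [hw])]

lemma wordExp_add (n : ℕ) (f g : List α → ℝ) (a : α) :
    wordExp P n (fun w => f w + g w) a = wordExp P n f a + wordExp P n g a := by
  induction n generalizing f g a with
  | zero => rfl
  | succ n ih => simp only [wordExp, ih, mul_add, Finset.sum_add_distrib]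

lemma wordExp_const_mul (n : ℕ) (c : ℝ) (f : List α → ℝ) (a : α) :
    wordExp P n (fun w => c * f w) a = c * wordExp P n f a := by
  induction n generalizing f a with
  | zero => rfl
  | succ n ih => simp only [wordExp, ih, Finset.mul_sum, mul_left_comm]

/-- The Markov property. -/
lemma wordExp_append (m n : ℕ) (f : List α → ℝ) (a : α) :
    wordExp P (m + n) f a =
      wordExp P m (fun w => wordExp P n (fun w' => f (w ++ w')) (w.getLastD a)) a := by
  induction m generalizing f a with
  | zero => simp [wordExp]
  | succ m ih =>
    rw [show m + 1 + n = m + n + 1 by omega]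
    simp only [wordExp, ih, List.cons_append, List.getLastD_cons]

lemma wordExp_mono (hP : ∀ i j, 0 ≤ P i j) {n : ℕ} {f g : List α → ℝ} {a : α}
    (h : ∀ w, w.length = n → f w ≤ g w) : wordExp P n f a ≤ wordExp P n g a := by
  induction n generalizing f g a with
  | zero => exact h [] rfl
  | succ n ih =>
    exact Finset.sum_le_sum fun b _ => mul_le_mul_of_nonneg_left
      (ih fun w hw => h (b :: w) (by simp [hw])) (hP b a)

variable [DecidableEq α]

lemma wordExp_const (hP : P ∈ Matrix.colStochastic ℝ α) (n : ℕ) (c : ℝ) (a : α) :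
    wordExp P n (fun _ => c) a = c := by
  induction n generalizing a with
  | zero => rfl
  | succ n ih =>
    simp only [wordExp, ih, ← Finset.sum_mul, Matrix.sum_col_of_mem_colStochastic hP a, one_mul]

lemma wordExp_le_const (hP : P ∈ Matrix.colStochastic ℝ α) {n : ℕ} {f : List α → ℝ} {a : α}
    {c : ℝ} (h : ∀ w, w.length = n → f w ≤ c) : wordExp P n f a ≤ c :=
  (wordExp_mono (fun _ _ => Matrix.nonneg_of_mem_colStochastic hP) h).trans
    (wordExp_const hP n c a).le

lemma const_le_wordExp (hP : P ∈ Matrix.colStochastic ℝ α) {n : ℕ} {f : List α → ℝ} {a : α}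
    {c : ℝ} (h : ∀ w, w.length = n → c ≤ f w) : c ≤ wordExp P n f a :=
  (wordExp_const hP n c a).ge.trans
    (wordExp_mono (fun _ _ => Matrix.nonneg_of_mem_colStochastic hP) h)

/-- The law of the last letter is given by the power `P ^ n`; for `n = 0` this letter is the
starting letter `a`, the default value of `getLastD`. -/
lemma wordExp_getLastD (n : ℕ) (g : α → ℝ) (a : α) :
    wordExp P n (fun w => g (w.getLastD a)) a = ∑ b, (P ^ n) b a * g b := by
  induction n generalizing a with
  | zero => simp [wordExp, Matrix.one_apply]
  | succ n ih =>
    simp only [wordExp, List.getLastD_cons, ih, pow_succ, Matrix.mul_apply, Finset.sum_mul,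
      Finset.mul_sum]
    rw [Finset.sum_comm]
    exact Finset.sum_congr rfl fun b _ => Finset.sum_congr rfl fun c _ => by ring

end WordExp

/-! ### Runs of letters outside the singular set -/

section Runs

variable {α : Type*} [DecidableEq α]

/-- The number of letters of `w` before its first letter in `s`
(the length of `w` if there is none). -/
def headRun (s : Finset α) (w : List α) : ℕ := (w.takeWhile (· ∉ s)).length

/-- The number of letters of `w` after its last letter in `s`
(the length of `w` if there is none). -/
def tailRun (s : Finset α) (w : List α) : ℕ := headRun s w.reverse

variable {s : Finset α}

lemma headRun_cons_of_mem {a : α} (ha : a ∈ s) (w : List α) : headRun s (a :: w) = 0 := by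
  simp [headRun, ha]

lemma headRun_le (w : List α) : headRun s w ≤ w.length :=
  (List.takeWhile_prefix _).length_le

lemma tailRun_le (w : List α) : tailRun s w ≤ w.length := by
  simpa [tailRun] using headRun_le (s := s) w.reverse

lemma headRun_append_of_forall {w : List α} (h : ∀ a ∈ w, a ∉ s) (w' : List α) :
    headRun s (w ++ w') = w.length + headRun s w' := by
  rw [headRun, List.takeWhile_append_of_pos (by simpa using h), List.length_append, headRun]

lemma headRun_of_forall {w : List α} (h : ∀ a ∈ w, a ∉ s) : headRun s w = w.length := by
  simpa [headRun] using headRun_append_of_forall h []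

lemma exists_eq_append_cons {w : List α} (h : ¬ ∀ a ∈ w, a ∉ s) :
    ∃ u i v, w = u ++ i :: v ∧ (∀ a ∈ u, a ∉ s) ∧ i ∈ s := by
  induction w with
  | nil => simp at h
  | cons b w ih =>
    by_cases hb : b ∈ s
    · exact ⟨[], b, w, rfl, by simp, hb⟩
    · obtain ⟨u, i, v, rfl, hu, hi⟩ := ih fun h' => h <| by simpa [hb] using h'
      exact ⟨b :: u, i, v, rfl, by simpa [hb] using hu, hi⟩

lemma headRun_append_cons {u : List α} (hu : ∀ a ∈ u, a ∉ s) {i : α} (hi : i ∈ s) (v : List α) :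
    headRun s (u ++ i :: v) = u.length := by
  rw [headRun_append_of_forall hu, headRun_cons_of_mem hi, add_zero]

lemma headRun_append_of_not_forall {w : List α} (h : ¬ ∀ a ∈ w, a ∉ s) (w' : List α) :
    headRun s (w ++ w') = headRun s w := by
  obtain ⟨u, i, v, rfl, hu, hi⟩ := exists_eq_append_cons h
  rw [List.append_assoc, List.cons_append, headRun_append_cons hu hi, headRun_append_cons hu hi]

lemma exists_eq_append_cons' {w : List α} (h : ¬ ∀ a ∈ w, a ∉ s) :
    ∃ u i v, w = u ++ i :: v ∧ (∀ a ∈ v, a ∉ s) ∧ i ∈ s := by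
  obtain ⟨u, i, v, e, hu, hi⟩ := exists_eq_append_cons (w := w.reverse) (s := s) (by simpa using h)
  exact ⟨v.reverse, i, u.reverse, by simpa using congrArg List.reverse e, by simpa using hu, hi⟩

lemma tailRun_append_of_forall (w : List α) {w' : List α} (h : ∀ a ∈ w', a ∉ s) :
    tailRun s (w ++ w') = w'.length + tailRun s w := by
  rw [tailRun, List.reverse_append, headRun_append_of_forall (by simpa using h),
    List.length_reverse, tailRun]

lemma tailRun_append_of_not_forall (w : List α) {w' : List α} (h : ¬ ∀ a ∈ w', a ∉ s) :
    tailRun s (w ++ w') = tailRun s w' := by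
  rw [tailRun, List.reverse_append, headRun_append_of_not_forall (by simpa using h), tailRun]

lemma tailRun_of_forall {w : List α} (h : ∀ a ∈ w, a ∉ s) : tailRun s w = w.length := by
  rw [tailRun, headRun_of_forall (by simpa using h), List.length_reverse]

lemma tailRun_append_cons (u : List α) {v : List α} (hv : ∀ a ∈ v, a ∉ s) {i : α} (hi : i ∈ s) :
    tailRun s (u ++ i :: v) = v.length := by
  rw [tailRun, List.reverse_append, List.reverse_cons, List.append_assoc, List.singleton_append,
    headRun_append_cons (by simpa using hv) hi, List.length_reverse]

variable [Fintype α] {P : Matrix α α ℝ} {r : ℕ} {δ : ℝ}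

/-- If all entries of `P ^ r` are at least `δ`, a word of length `r` avoids a nonempty set of
letters with probability at most `1 - δ`: its last letter lies in the set with probability at
least `δ`. -/
lemma wordExp_avoid_le (hP : P ∈ Matrix.colStochastic ℝ α) (hr : 0 < r)
    (hδ : ∀ i j, δ ≤ (P ^ r) i j) (hs : s.Nonempty) (a : α) :
    wordExp P r (fun w => if ∀ b ∈ w, b ∉ s then 1 else 0) a ≤ 1 - δ := by
  obtain ⟨i, hi⟩ := hs
  have h1 : wordExp P r (fun w => (1 : ℝ) + (-1) * (if w.getLastD a = i then 1 else 0)) a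
      ≤ 1 - δ := by
    rw [wordExp_add, wordExp_const hP, wordExp_const_mul,
      wordExp_getLastD r (fun b => if b = i then (1 : ℝ) else 0) a]
    simp only [mul_ite, mul_one, mul_zero, Finset.sum_ite_eq', Finset.mem_univ, if_true]
    linarith [hδ i a]
  refine le_trans (wordExp_mono (fun _ _ => Matrix.nonneg_of_mem_colStochastic hP) ?_) h1
  intro w hw
  have hne : w ≠ [] := by rintro rfl; simp at hw; omega
  split_ifs with h2 h3 h3
  · exact absurd (h3 ▸ hi) (h2 _ (by
      rw [List.getLastD_eq_getLast?, List.getLast?_eq_getLast_of_ne_nil hne]; simp))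
  all_goals norm_num

/-- The run at the head of a word continues past the first `r` letters with probability at most
`1 - δ`, which gives a bound for its mean by induction on the length of the word. -/
lemma wordExp_headRun_le (hP : P ∈ Matrix.colStochastic ℝ α) (hr : 0 < r) (h0 : 0 < δ)
    (hδ : ∀ i j, δ ≤ (P ^ r) i j) (hs : s.Nonempty) (n : ℕ) (a : α) :
    wordExp P n (fun w => (headRun s w : ℝ)) a ≤ r / δ := by
  have h1 : δ ≤ 1 := by
    have := (const_le_wordExp hP (n := r) (c := 0) (f := fun w => if ∀ b ∈ w, b ∉ s then 1 else 0)
      (a := a) (fun w _ => by split_ifs <;> norm_num)).trans (wordExp_avoid_le hP hr hδ hs a)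
    linarith
  have hr' : (0 : ℝ) ≤ r / δ := by positivity
  induction n using Nat.strong_induction_on generalizing a with
  | _ n ih =>
  rcases lt_or_ge n r with h | h
  · refine wordExp_le_const hP fun w hw => ?_
    calc (headRun s w : ℝ) ≤ r := by exact_mod_cast (headRun_le w).trans (by omega)
      _ ≤ r / δ := by rw [le_div_iff₀ h0]; nlinarith [Nat.cast_nonneg (α := ℝ) r]
  · obtain ⟨n, rfl⟩ := Nat.exists_eq_add_of_le h
    rw [wordExp_append]
    calc _ ≤ wordExp P r (fun w => (r : ℝ) + (r / δ) * (if ∀ b ∈ w, b ∉ s then 1 else 0)) a := by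
          refine wordExp_mono (fun _ _ => Matrix.nonneg_of_mem_colStochastic hP) fun w hw => ?_
          split_ifs with h2
          · simp only [headRun_append_of_forall h2, hw, Nat.cast_add]
            rw [wordExp_add, wordExp_const hP]
            linarith [ih n (by omega) (w.getLastD a)]
          · simp only [headRun_append_of_not_forall h2]
            rw [wordExp_const hP, mul_zero, add_zero]
            exact_mod_cast (headRun_le w).trans hw.le
      _ ≤ r + r / δ * (1 - δ) := by
          rw [wordExp_add, wordExp_const hP, wordExp_const_mul]
          gcongr
          exact wordExp_avoid_le hP hr hδ hs a
      _ = r / δ := by field_simp; ring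

lemma wordExp_tailRun_le (hP : P ∈ Matrix.colStochastic ℝ α) (hr : 0 < r) (h0 : 0 < δ)
    (hδ : ∀ i j, δ ≤ (P ^ r) i j) (hs : s.Nonempty) (n : ℕ) (a : α) :
    wordExp P n (fun w => (tailRun s w : ℝ)) a ≤ r / δ := by
  have h1 : δ ≤ 1 := by
    have := (const_le_wordExp hP (n := r) (c := 0) (f := fun w => if ∀ b ∈ w, b ∉ s then 1 else 0)
      (a := a) (fun w _ => by split_ifs <;> norm_num)).trans (wordExp_avoid_le hP hr hδ hs a)
    linarith
  have hr' : (0 : ℝ) ≤ r / δ := by positivity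
  induction n using Nat.strong_induction_on generalizing a with
  | _ n ih =>
  rcases lt_or_ge n r with h | h
  · refine wordExp_le_const hP fun w hw => ?_
    calc (tailRun s w : ℝ) ≤ r := by exact_mod_cast (tailRun_le w).trans (by omega)
      _ ≤ r / δ := by rw [le_div_iff₀ h0]; nlinarith [Nat.cast_nonneg (α := ℝ) r]
  · obtain ⟨n, rfl⟩ := Nat.exists_eq_add_of_le' h
    rw [wordExp_append]
    calc _ ≤ wordExp P n (fun w => (r : ℝ) + (1 - δ) * tailRun s w) a := by
          refine wordExp_mono (fun _ _ => Matrix.nonneg_of_mem_colStochastic hP) fun w hw => ?_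
          calc _ ≤ wordExp P r (fun w' => (r : ℝ) + tailRun s w *
                (if ∀ b ∈ w', b ∉ s then 1 else 0)) (w.getLastD a) := by
                refine wordExp_mono (fun _ _ => Matrix.nonneg_of_mem_colStochastic hP)
                  fun w' hw' => ?_
                split_ifs with h2
                · simp [tailRun_append_of_forall w h2, hw']
                · rw [tailRun_append_of_not_forall w h2, mul_zero, add_zero]
                  exact_mod_cast (tailRun_le w').trans hw'.le
            _ ≤ r + (1 - δ) * tailRun s w := by
                rw [wordExp_add, wordExp_const hP, wordExp_const_mul, mul_comm (1 - δ)]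
                gcongr
                exact wordExp_avoid_le hP hr hδ hs _
      _ ≤ r + (1 - δ) * (r / δ) := by
          rw [wordExp_add, wordExp_const hP, wordExp_const_mul]
          have := ih n (by omega) a
          have h2 : 0 ≤ 1 - δ := by linarith
          gcongr
      _ = r / δ := by field_simp; ring

end Runs

/-! ### Linear growth of the mean -/

/-- A sequence which is additive up to a bounded error is linear up to a bounded error. -/
lemma exists_linear_of_quasiadditive {u : ℕ → ℝ} {D K : ℝ}
    (hK : ∀ n, |u n| ≤ K * n) (h : ∀ m n, |u (m + n) - (u m + u n)| ≤ D) :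
    ∃ L, ∀ n, |u n - n * L| ≤ D := by
  have hD : 0 ≤ D := (abs_nonneg _).trans (h 0 0)
  have h1 : Subadditive fun n => u n + D := fun m n => by
    have := abs_le.1 (h m n); linarith
  have h2 : Subadditive fun n => D - u n := fun m n => by
    have := abs_le.1 (h m n); linarith
  have bound : ∀ n : ℕ, |u n / n| ≤ |K| := fun n => by
    rcases n.eq_zero_or_pos with rfl | hn
    · simp
    · have hn' : (0 : ℝ) < n := by exact_mod_cast hn
      rw [abs_div, Nat.abs_cast, div_le_iff₀ hn']
      exact (hK n).trans (by gcongr; exact le_abs_self K)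
  have hdiv : ∀ n : ℕ, 0 ≤ D / n := fun n => by positivity
  have b1 : BddBelow (range fun n => (u n + D) / n) := ⟨-|K|, by
    rintro _ ⟨n, rfl⟩
    have := abs_le.1 (bound n)
    simp only [add_div]; linarith [hdiv n]⟩
  have b2 : BddBelow (range fun n => (D - u n) / n) := ⟨-|K|, by
    rintro _ ⟨n, rfl⟩
    have := abs_le.1 (bound n)
    simp only [sub_div]; linarith [hdiv n]⟩
  have hl : h2.lim = -h1.lim := by
    have t0 : Tendsto (fun n : ℕ => 2 * D / (n : ℝ)) atTop (𝓝 0) :=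
      tendsto_const_div_atTop_nhds_zero_nat _
    have t1 := (h1.tendsto_lim b1).add (h2.tendsto_lim b2)
    have := tendsto_nhds_unique (t1.congr (f₂ := fun n : ℕ => 2 * D / (n : ℝ)) fun n => by ring) t0
    linarith
  refine ⟨h1.lim, fun n => ?_⟩
  rcases n.eq_zero_or_pos with rfl | hn
  · have := hK 0
    simp only [Nat.cast_zero, mul_zero] at this
    simpa [abs_nonpos_iff.1 this] using hD
  · have hn' : (0 : ℝ) < n := by exact_mod_cast hn
    have e1 := h1.lim_le_div b1 hn.ne'
    have e2 := h2.lim_le_div b2 hn.ne'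
    rw [hl] at e2
    rw [le_div_iff₀ hn'] at e1 e2
    rw [abs_le]; constructor <;> linarith

section Mean

variable {α : Type*} [Fintype α] [DecidableEq α] {P : Matrix α α ℝ}

/-- If a superadditive function `Y` of words lies below a subadditive function `X` and both have
the same mean up to a bounded error, the means grow linearly, with errors bounded uniformly in the
starting letter. -/
lemma exists_linear_mean [Nonempty α] (hP : P ∈ Matrix.colStochastic ℝ α) {r : ℕ}
    (hr : ∀ i j, 0 < (P ^ r) i j) {X Y : List α → ℝ} {K C : ℝ}
    (hX : ∀ w w', X (w ++ w') ≤ X w + X w') (hY : ∀ w w', Y w + Y w' ≤ Y (w ++ w'))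
    (hYX : ∀ w, Y w ≤ X w) (hXK : ∀ w, |X w| ≤ K * w.length) (hYK : ∀ w, |Y w| ≤ K * w.length)
    (hXY : ∀ n a, wordExp P n X a ≤ wordExp P n Y a + C) :
    ∃ L B, ∀ n a, wordExp P n X a ≤ n * L + B ∧ n * L - B ≤ wordExp P n Y a := by
  have hP0 : ∀ i j, 0 ≤ P i j := fun _ _ => Matrix.nonneg_of_mem_colStochastic hP
  have addX : ∀ m n a, wordExp P (m + n) X a ≤
      wordExp P m X a + wordExp P m (fun w => wordExp P n X (w.getLastD a)) a := fun m n a => by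
    rw [wordExp_append, ← wordExp_add]
    refine wordExp_mono hP0 fun w _ => ?_
    rw [← wordExp_const hP n (X w) (w.getLastD a), ← wordExp_add]
    exact wordExp_mono hP0 fun w' _ => hX w w'
  have addY : ∀ m n a, wordExp P m Y a + wordExp P m (fun w => wordExp P n Y (w.getLastD a)) a ≤
      wordExp P (m + n) Y a := fun m n a => by
    rw [wordExp_append, ← wordExp_add]
    refine wordExp_mono hP0 fun w _ => ?_
    rw [← wordExp_const hP n (Y w) (w.getLastD a), ← wordExp_add]
    exact wordExp_mono hP0 fun w' _ => hY w w'
  have ltX : ∀ n a, wordExp P n X a ≤ K * n := fun n a => wordExp_le_const hP fun w hw =>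
    hw ▸ (le_abs_self _).trans (hXK w)
  have gtX : ∀ n a, -(K * n) ≤ wordExp P n X a := fun n a => const_le_wordExp hP fun w hw =>
    hw ▸ (abs_le.1 (hXK w)).1
  have gtY : ∀ n a, -(K * n) ≤ wordExp P n Y a := fun n a => const_le_wordExp hP fun w hw =>
    hw ▸ (abs_le.1 (hYK w)).1
  have leYX : ∀ n a, wordExp P n Y a ≤ wordExp P n X a := fun n a =>
    wordExp_mono hP0 fun w _ => hYX w
  obtain ⟨δ, hδ0, hδ⟩ : ∃ δ > 0, ∀ i j, δ ≤ (P ^ r) i j := by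
    obtain ⟨x, hx⟩ := Finite.exists_min fun x : α × α => (P ^ r) x.1 x.2
    exact ⟨_, hr x.1 x.2, fun i j => hx (i, j)⟩
  -- The first `r` letters forget the starting letter, which bounds the oscillation of the means.
  obtain ⟨B, hB⟩ : ∃ B, ∀ n a a', wordExp P n X a ≤ wordExp P n Y a' + B := by
    refine ⟨(2 * (K * r) + C) / δ + C, fun n a a' => ?_⟩
    obtain ⟨b, hb⟩ := Finite.exists_min fun b => wordExp P n Y b
    have h1 := addY r n b
    rw [wordExp_getLastD r (fun c => wordExp P n Y c) b] at h1
    have h2 : wordExp P n Y b + δ * (wordExp P n Y a - wordExp P n Y b) ≤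
        ∑ c, (P ^ r) c b * wordExp P n Y c := by
      have h3 : ∑ c, (P ^ r) c b = 1 :=
        Matrix.sum_col_of_mem_colStochastic (pow_mem hP r) b
      have h4 : (P ^ r) a b * (wordExp P n Y a - wordExp P n Y b) ≤
          ∑ c, (P ^ r) c b * (wordExp P n Y c - wordExp P n Y b) :=
        Finset.single_le_sum (f := fun c => (P ^ r) c b * (wordExp P n Y c - wordExp P n Y b))
          (fun c _ => mul_nonneg (hr c b).le (sub_nonneg.2 (hb c))) (Finset.mem_univ a)
      simp only [mul_sub, Finset.sum_sub_distrib, ← Finset.sum_mul, h3, one_mul] at h4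
      have h5 := mul_le_mul_of_nonneg_right (hδ a b) (sub_nonneg.2 (hb a))
      linarith
    have h6 : wordExp P (r + n) Y b ≤ wordExp P n Y b + C + K * r := by
      have h7 := addX n r b
      have h8 : wordExp P n (fun w => wordExp P r X (w.getLastD b)) b ≤ K * r :=
        wordExp_le_const hP fun w _ => ltX r _
      rw [add_comm r n]
      linarith [leYX (n + r) b, hXY n b]
    have h9 : δ * (wordExp P n Y a - wordExp P n Y b) ≤ 2 * (K * r) + C := by
      linarith [gtY r b]
    have h10 : wordExp P n Y a - wordExp P n Y b ≤ (2 * (K * r) + C) / δ := by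
      rw [le_div_iff₀ hδ0]; linarith
    linarith [hb a', hXY n a]
  obtain ⟨a₀⟩ := ‹Nonempty α›
  obtain ⟨L, hL⟩ := exists_linear_of_quasiadditive (u := fun n => wordExp P n X a₀) (K := K)
    (D := 2 * B) (fun n => abs_le.2 ⟨gtX n a₀, ltX n a₀⟩) fun m n => by
      have h1 : wordExp P m (fun w => wordExp P n X (w.getLastD a₀)) a₀ ≤ wordExp P n X a₀ + B :=
        wordExp_le_const hP fun w _ => (hB n _ a₀).trans (by linarith [leYX n a₀])
      have h2 : wordExp P n X a₀ - B ≤ wordExp P m (fun w => wordExp P n Y (w.getLastD a₀)) a₀ :=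
        const_le_wordExp hP fun w _ => by linarith [hB n a₀ (w.getLastD a₀)]
      have h0 : 0 ≤ B := by linarith [hB 0 a₀ a₀, leYX 0 a₀]
      rw [abs_le]
      constructor <;> linarith [addX m n a₀, addY m n a₀, leYX (m + n) a₀, hB m a₀ a₀]
  refine ⟨L, 3 * B, fun n a => ?_⟩
  have := abs_le.1 (hL n)
  constructor <;> linarith [hB n a a₀, hB n a₀ a, leYX n a₀]

end Mean

/-! ### Large deviations of subadditive functions of words -/

section Chernoff

variable {α : Type*} [Fintype α] [DecidableEq α] {P : Matrix α α ℝ}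

/-- The exponential moments of a subadditive function, maximized over the starting letter, are
submultiplicative; here for a decomposition into `N` blocks of length `m` and a rest of
length `t`. -/
lemma wordExp_exp_le_pow (hP : P ∈ Matrix.colStochastic ℝ α) {Z : List α → ℝ} {K Γ : ℝ}
    (hZ : ∀ w w', Z (w ++ w') ≤ Z w + Z w') (hK : ∀ w, |Z w| ≤ K * w.length) {m : ℕ}
    (hΓ : ∀ a, wordExp P m (fun w => Real.exp (Z w)) a ≤ Γ) (N t : ℕ) (a : α) :
    wordExp P (N * m + t) (fun w => Real.exp (Z w)) a ≤ Γ ^ N * Real.exp (K * t) := by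
  have hP0 : ∀ i j, 0 ≤ P i j := fun _ _ => Matrix.nonneg_of_mem_colStochastic hP
  have hΓ0 : 0 ≤ Γ := (const_le_wordExp hP fun w _ => (Real.exp_pos _).le).trans (hΓ a)
  induction N generalizing a with
  | zero =>
    simp only [zero_mul, zero_add, pow_zero, one_mul]
    exact wordExp_le_const hP fun w hw =>
      Real.exp_le_exp.2 (hw ▸ (le_abs_self _).trans (hK w))
  | succ N ih =>
    rw [show (N + 1) * m + t = m + (N * m + t) by ring, wordExp_append]
    calc _ ≤ wordExp P m (fun w => (Γ ^ N * Real.exp (K * t)) * Real.exp (Z w)) a := by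
          refine wordExp_mono hP0 fun w _ => ?_
          calc _ ≤ wordExp P (N * m + t) (fun w' => Real.exp (Z w) * Real.exp (Z w'))
                (w.getLastD a) := wordExp_mono hP0 fun w' _ => by
                  rw [← Real.exp_add]; exact Real.exp_le_exp.2 (hZ w w')
            _ ≤ _ := by
                rw [wordExp_const_mul, mul_comm]
                exact mul_le_mul_of_nonneg_right (ih _) (Real.exp_pos _).le
      _ ≤ (Γ ^ N * Real.exp (K * t)) * Γ := by
          rw [wordExp_const_mul]
          exact mul_le_mul_of_nonneg_left (hΓ a) (by positivity)
      _ = _ := by ring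

/-- Chernoff's bound with blocks of length `m`. -/
lemma wordExp_deviation_le (hP : P ∈ Matrix.colStochastic ℝ α) {Z : List α → ℝ} {K B : ℝ}
    (hZ : ∀ w w', Z (w ++ w') ≤ Z w + Z w') (hK : ∀ w, |Z w| ≤ K * w.length) (hK1 : 1 ≤ K)
    (hB : 0 ≤ B) (hmean : ∀ n a, wordExp P n Z a ≤ B) {m n : ℕ} (hm : 0 < m)
    {θ : ℝ} (hθ : 0 ≤ θ) (hθ' : θ * (K * m) ≤ 1) (ε : ℝ) (a : α) :
    wordExp P n (fun w => if ε * n < Z w then 1 else 0) a ≤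
      Real.exp (θ * (-(ε * n) + B * n / m + θ * K ^ 2 * n * m + K * m)) := by
  have hP0 : ∀ i j, 0 ≤ P i j := fun _ _ => Matrix.nonneg_of_mem_colStochastic hP
  have hm' : (0 : ℝ) < m := by exact_mod_cast hm
  have hZθ : ∀ w w', θ * Z (w ++ w') ≤ θ * Z w + θ * Z w' := fun w w' => by
    rw [← mul_add]; exact mul_le_mul_of_nonneg_left (hZ w w') hθ
  have hKθ : ∀ w, |θ * Z w| ≤ (θ * K) * w.length := fun w => by
    rw [abs_mul, abs_of_nonneg hθ, mul_assoc]; exact mul_le_mul_of_nonneg_left (hK w) hθ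
  have hΓ : ∀ a, wordExp P m (fun w => Real.exp (θ * Z w)) a ≤
      Real.exp (θ * B + (θ * (K * m)) ^ 2) := fun a => by
    calc _ ≤ wordExp P m (fun w => (1 + (θ * (K * m)) ^ 2) + θ * Z w) a := by
          refine wordExp_mono hP0 fun w hw => ?_
          have h1 : |θ * Z w| ≤ θ * (K * m) := by rw [← hw, ← mul_assoc]; exact hKθ w
          have h2 := abs_le.1 (Real.abs_exp_sub_one_sub_id_le (h1.trans hθ'))
          have h3 : (θ * Z w) ^ 2 ≤ (θ * (K * m)) ^ 2 := sq_le_sq' (abs_le.1 h1).1 (abs_le.1 h1).2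
          linarith
      _ ≤ (1 + (θ * (K * m)) ^ 2) + θ * B := by
          rw [wordExp_add, wordExp_const hP, wordExp_const_mul]
          have := mul_le_mul_of_nonneg_left (hmean m a) hθ
          linarith
      _ ≤ _ := by
          have := Real.add_one_le_exp (θ * B + (θ * (K * m)) ^ 2)
          linarith
  have h1 := wordExp_exp_le_pow hP hZθ hKθ hΓ (n / m) (n % m) a
  rw [Nat.div_add_mod'] at h1
  calc _ ≤ wordExp P n (fun w => Real.exp (-(θ * (ε * n))) * Real.exp (θ * Z w)) a := by
        refine wordExp_mono hP0 fun w _ => ?_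
        rw [← Real.exp_add]
        split_ifs with h
        · refine Real.one_le_exp ?_
          have := mul_le_mul_of_nonneg_left h.le hθ
          linarith
        · exact (Real.exp_pos _).le
    _ ≤ Real.exp (-(θ * (ε * n))) * (Real.exp (θ * B + (θ * (K * m)) ^ 2) ^ (n / m) *
          Real.exp (θ * K * (n % m : ℕ))) := by
        rw [wordExp_const_mul]; exact mul_le_mul_of_nonneg_left h1 (Real.exp_pos _).le
    _ = Real.exp (-(θ * (ε * n)) + ((n / m : ℕ) * (θ * B + (θ * (K * m)) ^ 2) +
          θ * K * (n % m : ℕ))) := by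
        rw [← Real.exp_nat_mul, ← Real.exp_add, ← Real.exp_add]
    _ ≤ _ := by
        refine Real.exp_le_exp.2 ?_
        have e1 : ((n / m : ℕ) : ℝ) ≤ n / m := Nat.cast_div_le
        have e2 : ((n % m : ℕ) : ℝ) ≤ m := by exact_mod_cast (Nat.mod_lt n hm).le
        have e3 : (n / m : ℕ) * (θ * B + (θ * (K * m)) ^ 2) ≤
            (n / m : ℝ) * (θ * B + (θ * (K * m)) ^ 2) :=
          mul_le_mul_of_nonneg_right e1 (by positivity)
        have e4 : θ * K * (n % m : ℕ) ≤ θ * K * m :=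
          mul_le_mul_of_nonneg_left e2 (by positivity)
        have e5 : (n / m : ℝ) * (θ * B + (θ * (K * m)) ^ 2) =
            θ * (B * n / m + θ * K ^ 2 * n * m) := by field_simp
        linarith

/-- For `ε' = min 1 ε` and blocks of length `m ≈ √n` the Chernoff bound is `exp (-c ε'² √n)`. The
rate `c` depends on `Z`, but `√n` exceeds `n ^ (1/3)` by more than any constant factor once `n` is
large, and for the remaining `n` (as well as for `ε' = O(n ^ (-1/2))`) a constant prefactor
suffices. -/
lemma exists_wordExp_deviation_le (hP : P ∈ Matrix.colStochastic ℝ α) {Z : List α → ℝ} {K B : ℝ}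
    (hZ : ∀ w w', Z (w ++ w') ≤ Z w + Z w') (hK : ∀ w, |Z w| ≤ K * w.length) (hK1 : 1 ≤ K)
    (hB : 0 ≤ B) (hmean : ∀ n a, wordExp P n Z a ≤ B) :
    ∃ C : ℝ, ∀ ε : ℝ, 0 < ε → ∀ n : ℕ, 1 ≤ n → ∀ a,
      wordExp P n (fun w => if ε * n < Z w then 1 else 0) a ≤
        C * Real.exp (-(min 1 (ε ^ 2)) * (n : ℝ) ^ (1 / 3 : ℝ)) := by
  set c₁ := 4 * (B + 2 * K) with hc₁
  have hc₁0 : 0 ≤ c₁ := by positivity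
  refine ⟨Real.exp (c₁ ^ 2 + (16 * K ^ 2) ^ 2), fun ε hε n hn a => ?_⟩
  rw [← Real.exp_add]
  have hn' : (1 : ℝ) ≤ n := by exact_mod_cast hn
  have hn0 : (0 : ℝ) < n := by linarith
  -- With `x = n ^ (1/6)` all exponents are polynomial in `x`.
  obtain ⟨x, hx1, hx6, hx3, hx2⟩ : ∃ x : ℝ, 1 ≤ x ∧ (n : ℝ) = x ^ 6 ∧ √(n : ℝ) = x ^ 3 ∧
      (n : ℝ) ^ (1 / 3 : ℝ) = x ^ 2 := by
    refine ⟨(n : ℝ) ^ (1 / 6 : ℝ), Real.one_le_rpow hn' (by norm_num), ?_, ?_, ?_⟩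
    · rw [← Real.rpow_natCast, ← Real.rpow_mul hn0.le]; norm_num
    · rw [Real.sqrt_eq_rpow, ← Real.rpow_natCast, ← Real.rpow_mul hn0.le]; norm_num
    · rw [← Real.rpow_natCast, ← Real.rpow_mul hn0.le]; norm_num
  have hx0 : 0 < x := by linarith
  set e := min 1 ε with he
  have he0 : 0 < e := lt_min one_pos hε
  have he1 : e ≤ 1 := min_le_left _ _
  have hee : min 1 (ε ^ 2) = e ^ 2 := by
    rcases le_total 1 ε with h | h
    · rw [he, min_eq_left h, min_eq_left (by nlinarith)]; norm_num
    · rw [he, min_eq_right h, min_eq_right (by nlinarith)]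
  rw [hee, hx2]
  have triv : wordExp P n (fun w => if ε * n < Z w then 1 else 0) a ≤ 1 :=
    wordExp_le_const hP fun w _ => by split_ifs <;> norm_num
  rcases lt_or_ge (e * x ^ 3) c₁ with h | h
  · refine triv.trans (Real.one_le_exp ?_)
    have h1 : (e * x ^ 3) ^ 2 ≤ c₁ ^ 2 := pow_le_pow_left₀ (by positivity) h.le 2
    have h2 : e ^ 2 * x ^ 2 ≤ (e * x ^ 3) ^ 2 := by
      have : x ^ 2 ≤ x ^ 6 := pow_le_pow_right₀ hx1 (by norm_num)
      calc e ^ 2 * x ^ 2 ≤ e ^ 2 * x ^ 6 := by gcongr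
        _ = _ := by ring
    have : 0 ≤ (16 * K ^ 2) ^ 2 := by positivity
    linarith
  rcases lt_or_ge x (16 * K ^ 2) with h' | h'
  · refine triv.trans (Real.one_le_exp ?_)
    have h1 : x ^ 2 ≤ (16 * K ^ 2) ^ 2 := pow_le_pow_left₀ hx0.le h'.le 2
    have h2 : e ^ 2 * x ^ 2 ≤ 1 * x ^ 2 := by
      gcongr; exact pow_le_one₀ he0.le he1
    have : 0 ≤ c₁ ^ 2 := by positivity
    linarith
  -- With `θ = ε' / (4 K² m)` the quadratic term of `wordExp_deviation_le` is a quarter of `ε' n`.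
  set m := ⌈√(n : ℝ)⌉₊ with hm
  have hm1 : x ^ 3 ≤ m := hx3 ▸ Nat.le_ceil _
  have hx31 : 1 ≤ x ^ 3 := one_le_pow₀ hx1
  have hm2 : (m : ℝ) ≤ 2 * x ^ 3 := by
    have := Nat.ceil_lt_add_one (Real.sqrt_nonneg (n : ℝ))
    rw [hx3] at this; rw [hm, hx3]; linarith
  have hm0 : (0 : ℝ) < m := by linarith
  have hθ0 : 0 ≤ e / (4 * K ^ 2 * m) := by positivity
  refine (wordExp_deviation_le hP hZ hK hK1 hB hmean (m := m) (by exact_mod_cast hm0) hθ0 ?_ ε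
    a).trans (Real.exp_le_exp.2 ?_)
  · rw [div_mul_eq_mul_div, div_le_one (by positivity)]
    have : e * (K * m) ≤ 1 * (K * m) := by gcongr
    nlinarith [mul_pos (by linarith : 0 < K) hm0]
  · have hεe : e ≤ ε := min_le_right _ _
    have b1 : B * n / m ≤ B * x ^ 3 := by
      rw [div_le_iff₀ hm0, hx6]
      calc B * x ^ 6 = B * x ^ 3 * x ^ 3 := by ring
        _ ≤ _ := by gcongr
    have b2 : e / (4 * K ^ 2 * m) * K ^ 2 * n * m = e * n / 4 := by
      field_simp
    have b3 : K * m ≤ 2 * K * x ^ 3 := by nlinarith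
    have b4 : (B + 2 * K) * x ^ 3 ≤ e * n / 4 := by
      have : (B + 2 * K) * x ^ 3 ≤ (e * x ^ 3 / 4) * x ^ 3 := by
        gcongr; linarith
      rw [hx6]; linarith
    have b5 : -(ε * n) + B * n / m + e / (4 * K ^ 2 * m) * K ^ 2 * n * m + K * m ≤ -(e * n / 2) := by
      have : e * n ≤ ε * n := by gcongr
      rw [b2]; linarith
    have b6 : e ^ 2 * x ^ 2 ≤ e / (4 * K ^ 2 * m) * (e * n / 2) := by
      rw [div_mul_eq_mul_div, le_div_iff₀ (by positivity), hx6]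
      calc e ^ 2 * x ^ 2 * (4 * K ^ 2 * m) ≤ e ^ 2 * x ^ 2 * (4 * K ^ 2 * (2 * x ^ 3)) := by gcongr
        _ = e ^ 2 * x ^ 5 * (16 * K ^ 2) / 2 := by ring
        _ ≤ e ^ 2 * x ^ 5 * x / 2 := by gcongr
        _ = _ := by ring
    have b7 := mul_le_mul_of_nonneg_left b5 hθ0
    have : 0 ≤ c₁ ^ 2 + (16 * K ^ 2) ^ 2 := by positivity
    linarith

end Chernoff

/-! ### Products of matrices along words -/

lemma norm_vecMulVec (v u : Fin 2 → ℝ) :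
    ‖(Matrix.vecMulVec v u : Mat2)‖ = ‖WithLp.toLp 2 v‖ * ‖WithLp.toLp 2 u‖ := by
  have h := InnerProductSpace.symm_toEuclideanLin_rankOne (𝕜 := ℝ) (WithLp.toLp 2 v)
    (WithLp.toLp 2 u)
  rw [LinearEquiv.symm_apply_eq] at h
  rw [← InnerProductSpace.norm_rankOne (𝕜 := ℝ), Matrix.l2_opNorm_def]
  congr 1
  ext1 x
  exact (congrArg (fun f => f x) h).symm

/-- The norm of a product factors at a rank one matrix. -/
lemma norm_mul_vecMulVec_mul (C D : Mat2) (v u : Fin 2 → ℝ) :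
    ‖C * Matrix.vecMulVec v u * D‖ * ‖(Matrix.vecMulVec v u : Mat2)‖ =
      ‖C * Matrix.vecMulVec v u‖ * ‖Matrix.vecMulVec v u * D‖ := by
  simp only [Matrix.mul_vecMulVec, Matrix.vecMulVec_mul, norm_vecMulVec]
  ring

variable {k : ℕ}

/-- The product `A_{ωₙ} ⋯ A_{ω₁}` along the word `ω₁ ⋯ ωₙ`. -/
def wordProd (A : Fin k → Mat2) : List (Fin k) → Mat2
  | [] => 1
  | b :: w => wordProd A w * A b

lemma wordProd_append (A : Fin k → Mat2) (w w' : List (Fin k)) :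
    wordProd A (w ++ w') = wordProd A w' * wordProd A w := by
  induction w with
  | nil => simp [wordProd]
  | cons b w ih => simp [wordProd, ih, mul_assoc]

/-- A quantitative nondegeneracy condition on a cocycle. The last condition, which holds for almost
every cocycle, says that the scalar by which a block of invertible matrices between two rank one
matrices acts is at least exponentially small in the length of the block. -/
structure IsNondegenerate (A : Fin k → Mat2) (sing : Finset (Fin k)) (K : ℝ) : Prop where
  norm_le : ∀ b, ‖A b‖ ≤ Real.exp K
  le_mul_right : ∀ b ∉ sing, ∀ B : Mat2, ‖B‖ ≤ Real.exp K * ‖B * A b‖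
  le_mul_left : ∀ b ∉ sing, ∀ B : Mat2, ‖B‖ ≤ Real.exp K * ‖A b * B‖
  exists_eq_vecMulVec : ∀ b ∈ sing, ∃ v u, A b = Matrix.vecMulVec v u
  le_norm_block : ∀ i ∈ sing, ∀ j ∈ sing, ∀ w : List (Fin k), (∀ b ∈ w, b ∉ sing) →
    1 ≤ Real.exp (K * (w.length + 1)) * ‖A j * wordProd A w * A i‖

namespace IsNondegenerate

variable {A : Fin k → Mat2} {sing : Finset (Fin k)} {K : ℝ} (hA : IsNondegenerate A sing K)
include hA

lemma norm_wordProd_le (w : List (Fin k)) : ‖wordProd A w‖ ≤ Real.exp (K * w.length) := by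
  induction w with
  | nil => simp [wordProd]
  | cons b w ih =>
    calc ‖wordProd A w * A b‖ ≤ Real.exp (K * w.length) * Real.exp K :=
          (norm_mul_le _ _).trans (mul_le_mul ih (hA.norm_le b) (norm_nonneg _)
            (Real.exp_pos _).le)
      _ = _ := by rw [← Real.exp_add]; congr 1; push_cast [List.length_cons]; ring

lemma le_mul_wordProd {w : List (Fin k)} (hw : ∀ b ∈ w, b ∉ sing) (B : Mat2) :
    ‖B‖ ≤ Real.exp (K * w.length) * ‖B * wordProd A w‖ := by
  induction w generalizing B with
  | nil => simp [wordProd]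
  | cons b w ih =>
    calc ‖B‖ ≤ Real.exp (K * w.length) * ‖B * wordProd A w‖ := ih (by simp_all) B
      _ ≤ Real.exp (K * w.length) * (Real.exp K * ‖B * wordProd A w * A b‖) := by
          gcongr; exact hA.le_mul_right b (hw b (by simp)) _
      _ = _ := by
          rw [← mul_assoc, ← Real.exp_add, mul_assoc B, wordProd]
          congr 2; push_cast [List.length_cons]; ring

lemma le_wordProd_mul {w : List (Fin k)} (hw : ∀ b ∈ w, b ∉ sing) (B : Mat2) :
    ‖B‖ ≤ Real.exp (K * w.length) * ‖wordProd A w * B‖ := by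
  induction w generalizing B with
  | nil => simp [wordProd]
  | cons b w ih =>
    calc ‖B‖ ≤ Real.exp K * ‖A b * B‖ := hA.le_mul_left b (hw b (by simp)) B
      _ ≤ Real.exp K * (Real.exp (K * w.length) * ‖wordProd A w * (A b * B)‖) := by
          gcongr; exact ih (by simp_all) _
      _ = _ := by
          rw [← mul_assoc, ← Real.exp_add, ← mul_assoc, wordProd]
          congr 2; push_cast [List.length_cons]; ring

/-- Cutting a product between two rank one factors costs at most an exponential in the distance
of these factors from the cut. -/
lemma norm_mul_norm_le {w w' : List (Fin k)} (hw : ¬ ∀ b ∈ w, b ∉ sing)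
    (hw' : ¬ ∀ b ∈ w', b ∉ sing) :
    ‖wordProd A w‖ * ‖wordProd A w'‖ ≤
      Real.exp (K * (2 * tailRun sing w + 2 * headRun sing w' + 3)) * ‖wordProd A (w ++ w')‖ := by
  obtain ⟨u, i, v, rfl, hv, hi⟩ := exists_eq_append_cons' hw
  obtain ⟨h, j, t, rfl, hh, hj⟩ := exists_eq_append_cons hw'
  rw [tailRun_append_cons u hv hi, headRun_append_cons hh hj]
  simp only [wordProd_append, wordProd]
  set U := wordProd A u
  set V := wordProd A v
  set H := wordProd A h
  set T := wordProd A t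
  have hblock := hA.le_norm_block i hi j hj (v ++ h) (by
    intro b hb; rcases List.mem_append.1 hb with h1 | h1 <;> simp_all)
  rw [wordProd_append, List.length_append, Nat.cast_add] at hblock
  have e1 : ‖A j * (H * V) * A i * U‖ * ‖A i‖ = ‖A j * (H * V) * A i‖ * ‖A i * U‖ := by
    obtain ⟨x, y, hxy⟩ := hA.exists_eq_vecMulVec i hi
    rw [hxy]; exact norm_mul_vecMulVec_mul _ _ _ _
  have e2 : ‖T * A j * (H * V * A i * U)‖ * ‖A j‖ = ‖T * A j‖ * ‖A j * (H * V * A i * U)‖ := by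
    obtain ⟨x, y, hxy⟩ := hA.exists_eq_vecMulVec j hj
    rw [hxy]; exact norm_mul_vecMulVec_mul _ _ _ _
  have e3 : A j * (H * V) * A i * U = A j * (H * V * A i * U) := by simp only [mul_assoc]
  rw [e3] at e1
  have e4 : T * A j * H * (V * A i * U) = T * A j * (H * V * A i * U) := by simp only [mul_assoc]
  have n1 : ‖V * A i * U‖ ≤ Real.exp (K * v.length) * ‖A i * U‖ := by
    rw [mul_assoc]
    exact (norm_mul_le _ _).trans (by gcongr; exact hA.norm_wordProd_le v)
  have n2 : ‖T * A j * H‖ ≤ ‖T * A j‖ * Real.exp (K * h.length) :=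
    (norm_mul_le _ _).trans (by gcongr; exact hA.norm_wordProd_le h)
  have key : ‖A i * U‖ * ‖T * A j‖ ≤
      Real.exp (K * (v.length + h.length + 1)) * (Real.exp K * Real.exp K) *
        ‖T * A j * (H * V * A i * U)‖ := by
    calc ‖A i * U‖ * ‖T * A j‖
        ≤ (Real.exp (K * (v.length + h.length + 1)) * ‖A j * (H * V) * A i‖) *
          (‖A i * U‖ * ‖T * A j‖) := le_mul_of_one_le_left (by positivity) hblock
      _ = Real.exp (K * (v.length + h.length + 1)) * (‖T * A j‖ *
          (‖A j * (H * V) * A i‖ * ‖A i * U‖)) := by ring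
      _ = Real.exp (K * (v.length + h.length + 1)) *
          ((‖A i‖ * ‖A j‖) * ‖T * A j * (H * V * A i * U)‖) := by
          rw [← e1]
          linear_combination (-Real.exp (K * (v.length + h.length + 1)) * ‖A i‖) * e2
      _ ≤ Real.exp (K * (v.length + h.length + 1)) *
          ((Real.exp K * Real.exp K) * ‖T * A j * (H * V * A i * U)‖) := by
          gcongr <;> exact hA.norm_le _
      _ = _ := by ring
  rw [e4]
  calc _ ≤ (Real.exp (K * v.length) * ‖A i * U‖) * (‖T * A j‖ * Real.exp (K * h.length)) := by
        gcongr
    _ = Real.exp (K * v.length) * Real.exp (K * h.length) * (‖A i * U‖ * ‖T * A j‖) := by ring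
    _ ≤ Real.exp (K * v.length) * Real.exp (K * h.length) *
        (Real.exp (K * (v.length + h.length + 1)) * (Real.exp K * Real.exp K) *
          ‖T * A j * (H * V * A i * U)‖) := by gcongr
    _ = _ := by
        rw [← mul_assoc]
        simp only [← Real.exp_add]
        congr 2; ring

lemma exp_le_norm_of_mem {i : Fin k} (hi : i ∈ sing) : Real.exp (-(2 * K)) ≤ ‖A i‖ := by
  have h1 := hA.le_norm_block i hi i hi [] (by simp)
  simp only [wordProd, mul_one, List.length_nil, Nat.cast_zero, zero_add] at h1
  have h2 : 1 ≤ Real.exp K * (Real.exp K * ‖A i‖) := h1.trans (by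
    gcongr; exact (norm_mul_le _ _).trans (by gcongr; exact hA.norm_le i))
  rw [Real.exp_neg, inv_le_iff_one_le_mul₀ (Real.exp_pos _), two_mul, Real.exp_add]
  linarith

lemma norm_wordProd_pos (w : List (Fin k)) : 0 < ‖wordProd A w‖ := by
  induction w with
  | nil => simp [wordProd]
  | cons b w ih =>
    by_cases hb : b ∈ sing
    · have hb0 : 0 < ‖A b‖ := (Real.exp_pos _).trans_le (hA.exp_le_norm_of_mem hb)
      by_cases hw : ∀ c ∈ w, c ∉ sing
      · exact pos_of_mul_pos_right (hb0.trans_le (hA.le_wordProd_mul hw (A b)))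
          (Real.exp_pos _).le
      · have h := hA.norm_mul_norm_le (w := [b]) (by simpa using hb) hw
        refine pos_of_mul_pos_right (lt_of_lt_of_le ?_ h) (Real.exp_pos _).le
        simpa [wordProd] using mul_pos hb0 ih
    · exact pos_of_mul_pos_right (ih.trans_le (hA.le_mul_right b hb _)) (Real.exp_pos _).le

end IsNondegenerate

lemma log_le_of_le {x y z : ℝ} (hx : 0 < x) (hy : 0 < y) (h : x ≤ Real.exp z * y) :
    Real.log x ≤ z + Real.log y := by
  have := Real.log_le_log hx h
  rwa [Real.log_mul (Real.exp_pos z).ne' hy.ne', Real.log_exp] at this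

/-- The logarithm of the norm of the product along a word. -/
def logNorm (A : Fin k → Mat2) (w : List (Fin k)) : ℝ := Real.log ‖wordProd A w‖

/-- A superadditive lower bound for `logNorm`. It discounts the loss which may occur when the word
is continued on either side; this loss is controlled by the distance to the nearest rank one
factor. -/
def lowerLogNorm (A : Fin k → Mat2) (sing : Finset (Fin k)) (K : ℝ) (w : List (Fin k)) : ℝ :=
  if ∀ b ∈ w, b ∉ sing then -(3 * K * w.length)
  else logNorm A w - 2 * K * (headRun sing w + tailRun sing w) - 3 * K

namespace IsNondegenerate

variable {A : Fin k → Mat2} {sing : Finset (Fin k)} {K : ℝ} (hA : IsNondegenerate A sing K)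
include hA

lemma logNorm_append_le (w w' : List (Fin k)) :
    logNorm A (w ++ w') ≤ logNorm A w + logNorm A w' := by
  rw [logNorm, logNorm, logNorm, ← Real.log_mul (hA.norm_wordProd_pos w).ne'
    (hA.norm_wordProd_pos w').ne', wordProd_append, mul_comm]
  refine Real.log_le_log ?_ (norm_mul_le _ _)
  rw [← wordProd_append]; exact hA.norm_wordProd_pos _

lemma logNorm_le (w : List (Fin k)) : logNorm A w ≤ K * w.length := by
  rw [logNorm, Real.log_le_iff_le_exp (hA.norm_wordProd_pos w)]
  exact hA.norm_wordProd_le w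

lemma logNorm_ge_of_forall {w : List (Fin k)} (hw : ∀ b ∈ w, b ∉ sing) :
    -(K * w.length) ≤ logNorm A w := by
  have := log_le_of_le one_pos (hA.norm_wordProd_pos w)
    (by simpa using hA.le_mul_wordProd hw 1)
  rw [Real.log_one] at this
  rw [logNorm]; linarith

lemma lowerLogNorm_append_ge (w w' : List (Fin k)) :
    lowerLogNorm A sing K w + lowerLogNorm A sing K w' ≤ lowerLogNorm A sing K (w ++ w') := by
  have hall : (∀ b ∈ w ++ w', b ∉ sing) ↔ (∀ b ∈ w, b ∉ sing) ∧ (∀ b ∈ w', b ∉ sing) :=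
    List.forall_mem_append
  by_cases hw : ∀ b ∈ w, b ∉ sing <;> by_cases hw' : ∀ b ∈ w', b ∉ sing
  · rw [lowerLogNorm, lowerLogNorm, lowerLogNorm, if_pos hw, if_pos hw',
      if_pos (hall.2 ⟨hw, hw'⟩), List.length_append, Nat.cast_add]
    linarith
  · rw [lowerLogNorm, lowerLogNorm, lowerLogNorm, if_pos hw, if_neg hw', if_neg (by tauto),
      headRun_append_of_forall hw, tailRun_append_of_not_forall w hw']
    have := log_le_of_le (hA.norm_wordProd_pos w') (hA.norm_wordProd_pos (w ++ w'))
      (by rw [wordProd_append]; exact hA.le_mul_wordProd hw _)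
    simp only [logNorm, Nat.cast_add]
    linarith
  · rw [lowerLogNorm, lowerLogNorm, lowerLogNorm, if_neg hw, if_pos hw', if_neg (by tauto),
      headRun_append_of_not_forall hw, tailRun_append_of_forall w hw']
    have := log_le_of_le (hA.norm_wordProd_pos w) (hA.norm_wordProd_pos (w ++ w'))
      (by rw [wordProd_append]; exact hA.le_wordProd_mul hw' _)
    simp only [logNorm, Nat.cast_add]
    linarith
  · rw [lowerLogNorm, lowerLogNorm, lowerLogNorm, if_neg hw, if_neg hw', if_neg (by tauto),
      headRun_append_of_not_forall hw, tailRun_append_of_not_forall w hw']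
    have := log_le_of_le (mul_pos (hA.norm_wordProd_pos w) (hA.norm_wordProd_pos w'))
      (hA.norm_wordProd_pos (w ++ w')) (hA.norm_mul_norm_le hw hw')
    rw [Real.log_mul (hA.norm_wordProd_pos w).ne' (hA.norm_wordProd_pos w').ne'] at this
    simp only [logNorm]
    linarith

variable (hK : 0 ≤ K)
include hK

lemma lowerLogNorm_le (w : List (Fin k)) : lowerLogNorm A sing K w ≤ logNorm A w := by
  rw [lowerLogNorm]
  split_ifs with hw
  · have := hA.logNorm_ge_of_forall hw
    have : 0 ≤ K * w.length := by positivity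
    linarith
  · have : 0 ≤ 2 * K * (headRun sing w + tailRun sing w) := by positivity
    linarith

lemma logNorm_sub_lowerLogNorm_le (w : List (Fin k)) :
    logNorm A w ≤ lowerLogNorm A sing K w +
      (2 * K * headRun sing w + (2 * K * tailRun sing w + 3 * K)) := by
  rw [lowerLogNorm]
  split_ifs with hw
  · rw [headRun_of_forall hw, tailRun_of_forall hw]
    linarith [hA.logNorm_le w]
  · linarith

lemma lowerLogNorm_ge (w : List (Fin k)) : -(5 * K * w.length) ≤ lowerLogNorm A sing K w := by
  induction w with
  | nil => simp [lowerLogNorm]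
  | cons b w ih =>
    have h := hA.lowerLogNorm_append_ge [b] w
    have hb : -(5 * K) ≤ lowerLogNorm A sing K [b] := by
      by_cases hb : b ∈ sing
      · have h1 := Real.log_le_log (Real.exp_pos _) (hA.exp_le_norm_of_mem hb)
        rw [Real.log_exp] at h1
        simp [lowerLogNorm, hb, logNorm, wordProd, tailRun, headRun]
        linarith
      · simp [lowerLogNorm, hb]
        linarith
    rw [List.singleton_append] at h
    push_cast [List.length_cons]
    linarith

/-- The deviations of `logNorm` from its linear mean growth, for the Markov chain on words. -/
theorem exists_deviation_bound {P : Matrix (Fin k) (Fin k) ℝ}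
    (hP : P ∈ Matrix.colStochastic ℝ (Fin k)) (hPp : P.IsPrimitive) (hs : sing.Nonempty) :
    ∃ L C : ℝ, ∀ ε : ℝ, 0 < ε → ∀ n : ℕ, 1 ≤ n → ∀ a,
      wordExp P n (fun w => if ε * n < |logNorm A w - n * L| then 1 else 0) a ≤
        C * Real.exp (-(min 1 (ε ^ 2)) * (n : ℝ) ^ (1 / 3 : ℝ)) := by
  have : Nonempty (Fin k) := hs.to_type
  have hP0 : ∀ i j, 0 ≤ P i j := fun _ _ => Matrix.nonneg_of_mem_colStochastic hP
  obtain ⟨r, hr, hpos⟩ := hPp.exists_pos_pow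
  obtain ⟨δ, hδ0, hδ⟩ : ∃ δ > 0, ∀ i j, δ ≤ (P ^ r) i j := by
    obtain ⟨x, hx⟩ := Finite.exists_min fun x : Fin k × Fin k => (P ^ r) x.1 x.2
    exact ⟨_, hpos x.1 x.2, fun i j => hx (i, j)⟩
  have hX : ∀ w, |logNorm A w| ≤ 5 * K * w.length := fun w => by
    have h1 := hA.lowerLogNorm_ge hK w
    have h2 := hA.lowerLogNorm_le hK w
    have h3 := hA.logNorm_le w
    have : 0 ≤ K * w.length := by positivity
    exact abs_le.2 ⟨by linarith, by linarith⟩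
  have hY : ∀ w, |lowerLogNorm A sing K w| ≤ 5 * K * w.length := fun w => by
    have h1 := hA.lowerLogNorm_ge hK w
    have h2 := hA.lowerLogNorm_le hK w
    have h3 := hA.logNorm_le w
    have : 0 ≤ K * w.length := by positivity
    exact abs_le.2 ⟨by linarith, by linarith⟩
  obtain ⟨L, B, hLB⟩ := exists_linear_mean hP hpos hA.logNorm_append_le hA.lowerLogNorm_append_ge
    (hA.lowerLogNorm_le hK) hX hY (C := 2 * K * (r / δ) + (2 * K * (r / δ) + 3 * K))
    fun n a => by
      refine (wordExp_mono hP0 fun w _ => hA.logNorm_sub_lowerLogNorm_le hK w).trans ?_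
      simp only [wordExp_add, wordExp_const_mul, wordExp_const hP]
      gcongr
      · exact wordExp_headRun_le hP hr hδ0 hδ hs n a
      · exact wordExp_tailRun_le hP hr hδ0 hδ hs n a
  have hB : 0 ≤ B := by
    have a : Fin k := Classical.arbitrary _
    have h1 := hLB 0 a
    have h2 : wordExp P 0 (lowerLogNorm A sing K) a ≤ wordExp P 0 (logNorm A) a :=
      hA.lowerLogNorm_le hK []
    simp only [Nat.cast_zero, zero_mul] at h1
    linarith
  have hlen : ∀ w : List (Fin k), 0 ≤ (w.length : ℝ) := fun w => Nat.cast_nonneg _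
  obtain ⟨C₁, hC₁⟩ := exists_wordExp_deviation_le hP (Z := fun w => logNorm A w + -(w.length * L))
    (K := 5 * K + |L| + 1) (B := B)
    (fun w w' => by
      have := hA.logNorm_append_le w w'
      simp only [List.length_append, Nat.cast_add]; linarith)
    (fun w => by
      refine (abs_add_le _ _).trans ?_
      rw [abs_neg, abs_mul, Nat.abs_cast]
      linarith [hX w, hlen w])
    (by linarith [abs_nonneg L]) hB
    (fun n a => by
      rw [wordExp_congr (g := fun w => logNorm A w + -(n * L)) fun w hw => by rw [hw],
        wordExp_add, wordExp_const hP]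
      linarith [hLB n a])
  obtain ⟨C₂, hC₂⟩ := exists_wordExp_deviation_le hP
    (Z := fun w => w.length * L + (-1) * lowerLogNorm A sing K w)
    (K := 5 * K + |L| + 1) (B := B)
    (fun w w' => by
      have := hA.lowerLogNorm_append_ge w w'
      simp only [List.length_append, Nat.cast_add]; linarith)
    (fun w => by
      refine (abs_add_le _ _).trans ?_
      rw [abs_mul, abs_mul, Nat.abs_cast, abs_neg, abs_one]
      linarith [hY w, hlen w])
    (by linarith [abs_nonneg L]) hB
    (fun n a => by
      rw [wordExp_congr (g := fun w => n * L + (-1) * lowerLogNorm A sing K w)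
        fun w hw => by rw [hw], wordExp_add, wordExp_const hP, wordExp_const_mul]
      linarith [hLB n a])
  refine ⟨L, C₁ + C₂, fun ε hε n hn a => ?_⟩
  rw [add_mul]
  refine le_trans ?_ (add_le_add (hC₁ ε hε n hn a) (hC₂ ε hε n hn a))
  rw [← wordExp_add]
  refine wordExp_mono hP0 fun w hw => ?_
  have hYX := hA.lowerLogNorm_le hK w
  rw [hw]
  split_ifs with h1 h2 h3 h3 h2 h3 h3 <;> norm_num
  rcases lt_abs.1 h1 with h | h <;> linarith

end IsNondegenerate

/-! ### From words to the shift space -/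

lemma iter_eq_wordProd (A : Fin k → Mat2) (ω : ℤ → Fin k) (n : ℕ) :
    iter A ω n = wordProd A (List.ofFn fun l : Fin n => ω ((l : ℕ) + 1)) := by
  induction n with
  | zero => simp [iter, wordProd]
  | succ n ih =>
    rw [List.ofFn_succ', List.concat_eq_append, wordProd_append]
    simp [iter, wordProd, ih]

/-- `wordExp` as a sum over words; `Fin.cons a w` is the word with the starting letter. -/
lemma wordExp_eq_sum {α : Type*} [Fintype α] (P : Matrix α α ℝ) (n : ℕ) (f : List α → ℝ) (a : α) :
    wordExp P n f a = ∑ w : Fin n → α,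
      (∏ l : Fin n, P ((Fin.cons a w : Fin (n + 1) → α) l.succ)
        ((Fin.cons a w : Fin (n + 1) → α) l.castSucc)) * f (List.ofFn w) := by
  induction n generalizing f a with
  | zero => simp [wordExp]
  | succ n ih =>
    rw [← (Fin.consEquiv fun _ => α).sum_comp, Fintype.sum_prod_type]
    simp only [wordExp, ih, Finset.mul_sum]
    refine Finset.sum_congr rfl fun b _ => Finset.sum_congr rfl fun w _ => ?_
    rw [Fin.prod_univ_succ]
    simp [Fin.consEquiv, List.ofFn_succ, mul_assoc]

/-- The law of the word `ω₁ ⋯ ωₙ` in terms of the chain started at `ω₀`; only an upper bound is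
needed. -/
lemma IsMarkovLaw.measure_le {P : Matrix (Fin k) (Fin k) ℝ} {q : Fin k → ℝ}
    {μ : Measure (ℤ → Fin k)} (hμ : IsMarkovLaw P q μ) (hP : ∀ i j, 0 ≤ P i j) (hq : ∀ i, 0 ≤ q i)
    (n : ℕ) (Q : List (Fin k) → Prop) [DecidablePred Q] :
    μ {ω | Q (List.ofFn fun l : Fin n => ω ((l : ℕ) + 1))} ≤
      ENNReal.ofReal (∑ a, q a * wordExp P n (fun w => if Q w then 1 else 0) a) := by
  have hsub : {ω : ℤ → Fin k | Q (List.ofFn fun l : Fin n => ω ((l : ℕ) + 1))} ⊆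
      ⋃ w ∈ Finset.univ.filter fun w : Fin (n + 1) → Fin k => Q (List.ofFn (Fin.tail w)),
        {ω | ∀ l : Fin (n + 1), ω (0 + (l : ℕ)) = w l} := fun ω hω => by
    simp only [Finset.mem_filter, Finset.mem_univ, true_and, mem_iUnion, exists_prop]
    exact ⟨fun l => ω (0 + (l : ℕ)), by simpa [Fin.tail_def] using hω, fun l => rfl⟩
  refine (measure_mono hsub).trans ((measure_biUnion_finset_le _ _).trans ?_)
  simp only [hμ.2 0 n]
  rw [← ENNReal.ofReal_sum_of_nonneg fun w _ =>
    mul_nonneg (hq _) (Finset.prod_nonneg fun l _ => hP _ _)]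
  refine ENNReal.ofReal_le_ofReal (le_of_eq ?_)
  rw [Finset.sum_filter, ← (Fin.consEquiv fun _ => Fin k).sum_comp, Fintype.sum_prod_type]
  refine Finset.sum_congr rfl fun a _ => ?_
  rw [wordExp_eq_sum, Finset.mul_sum]
  refine Finset.sum_congr rfl fun w _ => ?_
  simp [Fin.consEquiv, Fin.tail_def]

/-- A Bernoulli measure is the Markov measure whose transition probabilities do not depend on the
current letter. -/
lemma IsBernoulliMeasure.isMixingMarkovMeasure {μ : Measure (ℤ → Fin k)}
    (hμ : IsBernoulliMeasure μ) : IsMixingMarkovMeasure μ := by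
  obtain ⟨p, hp, rfl⟩ := hμ
  have hsum : ∑ i, (p i).toReal = 1 := by
    rw [← ENNReal.toReal_sum fun i _ => p.apply_ne_top i, ← tsum_fintype (L := .unconditional _),
      p.tsum_coe, ENNReal.toReal_one]
  refine ⟨Matrix.of fun i _ => (p i).toReal, fun i => (p i).toReal,
    Matrix.mem_colStochastic_iff_sum.2 ⟨fun _ _ => ENNReal.toReal_nonneg, fun _ => hsum⟩,
    ⟨fun _ _ => ENNReal.toReal_nonneg, 1, one_pos, fun i j => ?_⟩,
    ⟨fun _ => ENNReal.toReal_nonneg, hsum⟩, ?_, inferInstance, fun m n w => ?_⟩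
  · rw [pow_one]; exact ENNReal.toReal_pos (hp i) (p.apply_ne_top i)
  · ext i
    simp [Matrix.mulVec, dotProduct, ← Finset.mul_sum, hsum]
  · have hinj : Function.Injective fun l : Fin (n + 1) => m + ((l : ℕ) : ℤ) := fun a b h => by
      simpa [Fin.ext_iff] using h
    have hset : {ω : ℤ → Fin k | ∀ l : Fin (n + 1), ω (m + (l : ℕ)) = w l} =
        Set.pi (Finset.univ.map ⟨_, hinj⟩ : Finset ℤ)
          fun z => {i | ∀ l : Fin (n + 1), m + ((l : ℕ) : ℤ) = z → i = w l} := by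
      ext ω
      simp only [mem_ofPred_eq, Set.mem_pi, Finset.coe_map, Finset.coe_univ, image_univ,
        mem_range, Function.Embedding.coeFn_mk]
      constructor
      · rintro h _ _ l rfl; exact h l
      · intro h l; exact h _ ⟨l, rfl⟩ l rfl
    simp only [Matrix.of_apply]
    rw [hset, Measure.infinitePi_pi _ fun _ _ => MeasurableSet.of_discrete, Finset.prod_map,
      show (p (w 0)).toReal * ∏ l : Fin n, (p (w l.succ)).toReal = ∏ l, (p (w l)).toReal from
        (Fin.prod_univ_succ fun l => (p (w l)).toReal).symm, ENNReal.ofReal_prod_of_nonneg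
        fun _ _ => ENNReal.toReal_nonneg]
    refine Finset.prod_congr rfl fun l _ => ?_
    have : {i | ∀ l' : Fin (n + 1), m + ((l' : ℕ) : ℤ) =
        (⟨_, hinj⟩ : Fin (n + 1) ↪ ℤ) l → i = w l'} = {w l} := by
      ext i
      simp only [mem_ofPred_eq, mem_singleton_iff, Function.Embedding.coeFn_mk]
      exact ⟨fun h => h l rfl, fun h l' hl' => by rw [hinj hl', h]⟩
    rw [this, PMF.toMeasure_apply_singleton _ _ (measurableSet_singleton _),
      ENNReal.ofReal_toReal (p.apply_ne_top _)]

lemma summable_exp_neg_rpow {d : ℝ} (hd : 0 < d) :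
    Summable fun n : ℕ => Real.exp (-d * ((n + 1 : ℕ) : ℝ) ^ (1 / 3 : ℝ)) := by
  have h2 : Summable fun n : ℕ => (720 / d ^ 6) * (1 / ((n + 1 : ℕ) : ℝ) ^ 2) :=
    ((summable_nat_add_iff 1).2
      (Real.summable_one_div_nat_pow.2 (by norm_num : 1 < 2))).mul_left _
  refine h2.of_nonneg_of_le (fun n => (Real.exp_pos _).le) fun n => ?_
  have hn : (0 : ℝ) < ((n + 1 : ℕ) : ℝ) := by positivity
  set y := ((n + 1 : ℕ) : ℝ) ^ (1 / 3 : ℝ) with hy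
  have hy6 : y ^ 6 = ((n + 1 : ℕ) : ℝ) ^ 2 := by
    rw [hy, ← Real.rpow_natCast, ← Real.rpow_mul hn.le, ← Real.rpow_natCast]; norm_num
  have hy0 : 0 < y := Real.rpow_pos_of_pos hn _
  -- `exp (d y) ≥ (d y)⁶ / 6!`, and `y⁶` is the square of `n + 1`.
  have h := Real.pow_div_factorial_le_exp (d * y) (by positivity) 6
  rw [← hy6, neg_mul, Real.exp_neg, ← one_div, div_mul_div_comm, mul_one,
    div_le_div_iff₀ (Real.exp_pos _) (by positivity)]
  norm_num [Nat.factorial] at h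
  rw [mul_pow] at h
  linarith

namespace IsNondegenerate

variable {A : Fin k → Mat2} {sing : Finset (Fin k)} {K : ℝ} (hA : IsNondegenerate A sing K)
include hA

lemma growthRate_eq {n : ℕ} (ω : ℤ → Fin k) :
    growthRate A n ω =
      ((logNorm A (List.ofFn fun l : Fin n => ω ((l : ℕ) + 1)) / n : ℝ) : EReal) := by
  rw [growthRate, iter_eq_wordProd, ← ofReal_norm,
    ENNReal.log_ofReal_of_pos (hA.norm_wordProd_pos _), logNorm, EReal.coe_div]
  rfl

/-- The deviation estimate and the existence of the Lyapunov exponent for a nondegenerate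
cocycle. The almost sure convergence follows from the estimate by the Borel–Cantelli lemma. -/
theorem exists_lyapunov (hK : 0 ≤ K) (hs : sing.Nonempty) {μ : Measure (ℤ → Fin k)}
    (hμ : IsMixingMarkovMeasure μ) :
    ∃ L : ℝ, IsFirstLyapunovExponent μ A (L : EReal) ∧
      ∃ C : ℝ, ∀ ε : ℝ, 0 < ε → ∀ n : ℕ, 1 ≤ n →
        μ (deviationEvent A L ε n) ≤
          ENNReal.ofReal (C * Real.exp (-(min 1 (ε ^ 2)) * (n : ℝ) ^ (1 / 3 : ℝ))) := by
  obtain ⟨P, q, hP, hPp, hq, -, hμ⟩ := hμ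
  obtain ⟨L, C, hLC⟩ := hA.exists_deviation_bound hK hP hPp hs
  have hdev : ∀ ε : ℝ, 0 < ε → ∀ n : ℕ, 1 ≤ n → μ (deviationEvent A L ε n) ≤
      ENNReal.ofReal (C * Real.exp (-(min 1 (ε ^ 2)) * (n : ℝ) ^ (1 / 3 : ℝ))) := by
    intro ε hε n hn
    have hn' : (0 : ℝ) < n := by exact_mod_cast hn
    have hsub : deviationEvent A L ε n ⊆ {ω | ε * n <
        |logNorm A (List.ofFn fun l : Fin n => ω ((l : ℕ) + 1)) - n * L|} := fun ω hω => by
      rw [deviationEvent, mem_ofPred_eq, hA.growthRate_eq, ← EReal.coe_sub, EReal.abs_def] at hω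
      have h := (ENNReal.ofReal_lt_ofReal_iff'.1 hω).1
      rw [mem_ofPred_eq, ← lt_div_iff₀ hn', ← abs_of_pos hn', ← abs_div, abs_of_pos hn', sub_div,
        mul_div_cancel_left₀ _ hn'.ne']
      exact h
    refine (measure_mono hsub).trans ((hμ.measure_le
      (fun _ _ => Matrix.nonneg_of_mem_colStochastic hP) hq.1 n
      (fun w => ε * n < |logNorm A w - n * L|)).trans (ENNReal.ofReal_le_ofReal ?_))
    calc _ ≤ ∑ a, q a * (C * Real.exp (-(min 1 (ε ^ 2)) * (n : ℝ) ^ (1 / 3 : ℝ))) :=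
          Finset.sum_le_sum fun a _ => mul_le_mul_of_nonneg_left (hLC ε hε n hn a) (hq.1 a)
      _ = _ := by rw [← Finset.sum_mul, hq.2, one_mul]
  refine ⟨L, ?_, C, hdev⟩
  have hae : ∀ j : ℕ, ∀ᵐ ω ∂μ, ∀ᶠ n : ℕ in atTop,
      ω ∉ deviationEvent A L (1 / ((j : ℝ) + 1)) (n + 1) := fun j => by
    have hj : (0 : ℝ) < 1 / ((j : ℝ) + 1) := by positivity
    refine ae_eventually_notMem (ne_top_of_le_ne_top ?_ (ENNReal.tsum_le_tsum fun n =>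
      hdev _ hj (n + 1) (by omega)))
    refine Summable.tsum_ofReal_ne_top ?_
    exact (summable_exp_neg_rpow (lt_min one_pos (by positivity))).mul_left C
  filter_upwards [ae_all_iff.2 hae] with ω hω
  rw [← tendsto_add_atTop_iff_nat 1]
  simp only [hA.growthRate_eq]
  refine (continuous_coe_real_ereal.tendsto L).comp (Metric.tendsto_nhds.2 fun ε hε => ?_)
  obtain ⟨j, hj⟩ := exists_nat_one_div_lt hε
  filter_upwards [hω j] with n hn
  rw [deviationEvent, mem_ofPred_eq, hA.growthRate_eq, ← EReal.coe_sub, EReal.abs_def, not_lt] at hn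
  rw [Real.dist_eq]
  exact ((ENNReal.ofReal_le_ofReal_iff (by positivity)).1 hn).trans_lt hj

end IsNondegenerate

/-! ### Charts of the manifold of cocycles -/

/-- The coordinates of a chart: three for each rank one matrix and four for each invertible one. -/
abbrev ChartIndex (sing : Finset (Fin k)) : Type :=
  (sing × Fin 3) ⊕ ((singᶜ : Finset (Fin k)) × Fin 2 × Fin 2)

lemma card_chartIndex (sing : Finset (Fin k)) :
    Fintype.card (ChartIndex sing) = cocycleDim sing := by
  simp [cocycleDim, Fintype.card_sum, Fintype.card_prod, Finset.card_compl, mul_comm]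

/-- The row factor `(1, t)` or `(t, 1)` of a rank one matrix. -/
def chartRow (e : Bool) (t : ℝ) : Fin 2 → ℝ := if e then ![1, t] else ![t, 1]

/-- The column factor of a rank one matrix. -/
def chartCol {sing : Finset (Fin k)} (x : ChartIndex sing → ℝ) (i : sing) : Fin 2 → ℝ :=
  ![x (Sum.inl (i, 0)), x (Sum.inl (i, 1))]

/-- The parametrization of `cocycleManifold sing` which writes a rank one matrix as the product of
a column and of a row `(1, t)` or `(t, 1)`, as selected by `e`. -/
def chart {sing : Finset (Fin k)} (e : Fin k → Bool) (x : ChartIndex sing → ℝ) :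
    Fin k → Mat2 := fun i =>
  if h : i ∈ sing then
    Matrix.vecMulVec (chartCol x ⟨i, h⟩) (chartRow (e i) (x (Sum.inl (⟨i, h⟩, 2))))
  else Matrix.of fun a b => x (Sum.inr (⟨i, Finset.mem_compl.2 h⟩, a, b))

lemma exists_eq_vecMulVec_of_det_eq_zero {M : Mat2} (hM : M.det = 0) :
    ∃ e v t, M = Matrix.vecMulVec v (chartRow e t) := by
  rw [Matrix.det_fin_two] at hM
  by_cases h0 : M 0 0 = 0
  · by_cases h1 : M 1 0 = 0
    · refine ⟨false, ![M 0 1, M 1 1], 0, ?_⟩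
      ext a b
      fin_cases a <;> fin_cases b <;> simp [Matrix.vecMulVec_apply, chartRow, h0, h1]
    · refine ⟨true, ![M 0 0, M 1 0], M 1 1 / M 1 0, ?_⟩
      ext a b
      fin_cases a <;> fin_cases b <;> simp [Matrix.vecMulVec_apply, chartRow]
      · field_simp; linarith
      · field_simp
  · refine ⟨true, ![M 0 0, M 1 0], M 0 1 / M 0 0, ?_⟩
    ext a b
    fin_cases a <;> fin_cases b <;> simp [Matrix.vecMulVec_apply, chartRow]
    · field_simp
    · field_simp; linarith

lemma rank_eq_one_iff {M : Mat2} : M.rank = 1 ↔ M.det = 0 ∧ M ≠ 0 := by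
  constructor
  · intro h
    refine ⟨?_, fun h0 => by simp [h0] at h⟩
    by_contra hd
    have := Matrix.rank_of_isUnit M ((Matrix.isUnit_iff_isUnit_det M).2 (isUnit_iff_ne_zero.2 hd))
    simp [h] at this
  · rintro ⟨hd, h0⟩
    obtain ⟨e, v, t, rfl⟩ := exists_eq_vecMulVec_of_det_eq_zero hd
    refine le_antisymm (Matrix.rank_vecMulVec_le _ _) (Nat.one_le_iff_ne_zero.2 fun h => h0 ?_)
    rw [Matrix.rank, Submodule.finrank_eq_zero, LinearMap.range_eq_bot] at h
    exact Matrix.toLin'.map_eq_zero_iff.1 h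

lemma exists_chart_eq {sing : Finset (Fin k)} {A : Fin k → Mat2} (hA : A ∈ cocycleManifold sing) :
    ∃ e, ∃ x : ChartIndex sing → ℝ, chart e x = A := by
  have h : ∀ i : Fin k, ∃ e v t, i ∈ sing → A i = Matrix.vecMulVec v (chartRow e t) := fun i => by
    by_cases hi : i ∈ sing
    · obtain ⟨e, v, t, h⟩ := exists_eq_vecMulVec_of_det_eq_zero (rank_eq_one_iff.1 (hA.1 i hi)).1
      exact ⟨e, v, t, fun _ => h⟩
    · exact ⟨true, 0, 0, fun h => absurd h hi⟩
  choose e v t h using h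
  refine ⟨e, Sum.elim (fun z => ![v z.1 0, v z.1 1, t z.1] z.2) fun z => A z.1 z.2.1 z.2.2, ?_⟩
  ext1 i
  by_cases hi : i ∈ sing
  · rw [chart, dif_pos hi, h i hi]
    congr 1
    ext a; fin_cases a <;> simp [chartCol]
  · rw [chart, dif_neg hi]
    rfl

lemma contDiff_of_entries {E : Type*} [NormedAddCommGroup E] [NormedSpace ℝ E] {f : E → Mat2}
    (h : ∀ a b, ContDiff ℝ 1 fun x => f x a b) : ContDiff ℝ 1 f :=
  (LinearMap.toContinuousLinearMap
    (Matrix.ofLinearEquiv ℝ : (Fin 2 → Fin 2 → ℝ) ≃ₗ[ℝ] Mat2).toLinearMap).contDiff.comp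
    (contDiff_pi.2 fun a => contDiff_pi.2 fun b => h a b)

lemma contDiff_chart {sing : Finset (Fin k)} (e : Fin k → Bool) :
    ContDiff ℝ 1 (chart e : (ChartIndex sing → ℝ) → Fin k → Mat2) := by
  refine contDiff_pi.2 fun i => contDiff_of_entries fun a b => ?_
  by_cases hi : i ∈ sing
  · simp only [chart, dif_pos hi, Matrix.vecMulVec_apply]
    refine ContDiff.mul ?_ ?_
    · fin_cases a <;> simp [chartCol] <;> fun_prop
    · cases e i <;> fin_cases b <;> simp [chartRow] <;> fun_prop
  · simp only [chart, dif_neg hi, Matrix.of_apply]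
    fun_prop

lemma _root_.LocallyLipschitz.hausdorffMeasure_image_eq_zero {X Y : Type*} [EMetricSpace X]
    [EMetricSpace Y] [MeasurableSpace X] [BorelSpace X] [MeasurableSpace Y] [BorelSpace Y]
    [SecondCountableTopology X] {f : X → Y} (hf : LocallyLipschitz f) {d : ℝ} (hd : 0 ≤ d)
    {s : Set X} (hs : Measure.hausdorffMeasure d s = 0) :
    Measure.hausdorffMeasure d (f '' s) = 0 := by
  choose K t ht hK using hf
  obtain ⟨c, hc, hcov⟩ := TopologicalSpace.countable_cover_nhds ht
  have hsub : f '' s ⊆ ⋃ x ∈ c, f '' (s ∩ t x) := by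
    rintro _ ⟨y, hy, rfl⟩
    have : y ∈ ⋃ x ∈ c, t x := hcov ▸ mem_univ y
    simp only [mem_iUnion, exists_prop] at this ⊢
    obtain ⟨x, hx, hyx⟩ := this
    exact ⟨x, hx, mem_image_of_mem f ⟨hy, hyx⟩⟩
  refine measure_mono_null hsub ((measure_biUnion_null_iff hc).2 fun x _ => ?_)
  refine le_antisymm ((((hK x).mono inter_subset_right).hausdorffMeasure_image_le hd).trans ?_)
    zero_le
  rw [measure_mono_null inter_subset_left hs, mul_zero]

/-! ### Almost every affine function is not too small -/

/-- The set where an affine function is small compared with its coefficients is a short interval,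
unless the slope is so small that the set is empty in `[-R, R]` for `s ≤ 1 / 2`; for larger `s` the
length of `[-R, R]` is a sufficient bound. -/
lemma volume_abs_affine_lt_le (a b : ℝ) {R : ℝ} (hR : 0 ≤ R) {s : ℝ} (hs : 0 ≤ s) :
    volume {t ∈ Icc (-R) R | |a + t * b| < s * (|a| + |b|)} ≤
      ENNReal.ofReal (4 * (R + 1) * s) := by
  rcases le_or_gt (|a| + |b|) (2 * (R + 1) * |b|) with h | h
  · rcases eq_or_ne b 0 with rfl | hb
    · have ha : a = 0 := by
        have : |a| ≤ 0 := by simpa using h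
        exact abs_nonpos_iff.1 this
      simp [ha]
    have hb' : 0 < |b| := abs_pos.2 hb
    calc _ ≤ volume (Metric.ball (-(a / b)) (2 * (R + 1) * s)) := by
          refine measure_mono fun t ht => ?_
          rw [Metric.mem_ball, Real.dist_eq, ← mul_lt_mul_iff_left₀ hb', ← abs_mul]
          have e : (t - -(a / b)) * b = a + t * b := by field_simp; ring
          rw [e]
          calc |a + t * b| < s * (|a| + |b|) := ht.2
            _ ≤ s * (2 * (R + 1) * |b|) := by gcongr
            _ = _ := by ring
      _ = _ := by rw [Real.volume_ball]; congr 1; ring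
  · rcases le_or_gt s (1 / 2) with h' | h'
    · have : {t ∈ Icc (-R) R | |a + t * b| < s * (|a| + |b|)} = ∅ := by
        refine eq_empty_of_forall_notMem fun t ht => ?_
        have h1 : |t * b| ≤ R * |b| := by
          rw [abs_mul]; gcongr; exact abs_le.2 ht.1
        have h2 : |a| - |t * b| ≤ |a + t * b| := by
          have := abs_sub_abs_le_abs_sub a (-(t * b)); rwa [abs_neg, sub_neg_eq_add] at this
        have h3 : s * (|a| + |b|) ≤ 1 / 2 * (|a| + |b|) := by gcongr
        have h4 := ht.2
        linarith
      rw [this, measure_empty]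
      exact zero_le
    · calc _ ≤ volume (Icc (-R) R) := measure_mono fun t ht => ht.1
        _ ≤ _ := by
          rw [Real.volume_Icc]; refine ENNReal.ofReal_le_ofReal ?_
          nlinarith

lemma exists_chartRow_dotProduct_eq (e : Bool) :
    ∃ p q : Fin 2, ∀ (y : Fin 2 → ℝ) (t : ℝ),
      chartRow e t ⬝ᵥ y = y p + t * y q ∧ ‖y‖ ≤ |y p| + |y q| := by
  cases e
  · refine ⟨1, 0, fun y t => ⟨?_, (pi_norm_le_iff_of_nonneg (by positivity)).2 fun a => ?_⟩⟩
    · simp [chartRow, dotProduct, Fin.sum_univ_two, add_comm]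
    · fin_cases a <;> simp
  · refine ⟨0, 1, fun y t => ⟨?_, (pi_norm_le_iff_of_nonneg (by positivity)).2 fun a => ?_⟩⟩
    · simp [chartRow, dotProduct, Fin.sum_univ_two]
    · fin_cases a <;> simp

/-- Borel–Cantelli: for almost every `t` the affine functions `a i + t * b i` are bounded below by a
constant multiple of summable weights. -/
lemma ae_exists_le_abs_affine {ι : Type*} [Countable ι] (a b r : ι → ℝ) (hr : ∀ i, 0 < r i)
    (hsum : Summable r) :
    ∀ᵐ t : ℝ, ∃ c > 0, ∀ i, c * (r i * (|a i| + |b i|)) ≤ |a i + t * b i| := by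
  have hfin : ∀ᵐ t : ℝ, ∀ R : ℕ, {i | t ∈ {t ∈ Icc (-(R : ℝ)) R |
      |a i + t * b i| < r i * (|a i| + |b i|)}}.Finite := by
    refine ae_all_iff.2 fun R => ae_finite_setOfPred_mem (ne_top_of_le_ne_top ?_
      (ENNReal.tsum_le_tsum fun i =>
        volume_abs_affine_lt_le (a i) (b i) (Nat.cast_nonneg R) (hr i).le))
    exact (hsum.mul_left _).tsum_ofReal_ne_top
  have hne : ∀ᵐ t : ℝ, ∀ i, 0 < |a i| + |b i| → a i + t * b i ≠ 0 := by
    refine ae_all_iff.2 fun i => ?_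
    by_cases hi : 0 < |a i| + |b i|
    · refine measure_mono_null (t := {t | a i + t * b i = 0}) (fun t ht => ?_)
        (Set.Subsingleton.measure_zero (fun t ht s hs => ?_) _)
      · by_contra h
        exact ht fun _ => h
      · simp only [mem_ofPred_eq] at ht hs
        have hb : b i ≠ 0 := fun hb => by
          rw [hb, mul_zero, add_zero] at ht
          simp [ht, hb] at hi
        exact mul_right_cancel₀ hb (by linarith)
    · exact Eventually.of_forall fun t h => absurd h hi
  filter_upwards [hfin, hne] with t h1 h2
  obtain ⟨R, hR⟩ := exists_nat_ge |t|
  have h3 : ∀ᶠ c : ℝ in 𝓝[>] 0, ∀ i ∈ {i | t ∈ {t ∈ Icc (-(R : ℝ)) R |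
      |a i + t * b i| < r i * (|a i| + |b i|)}}, c * (r i * (|a i| + |b i|)) ≤ |a i + t * b i| := by
    refine (eventually_all_finite (h1 R)).2 fun i hi => ?_
    have hpos : 0 < |a i| + |b i| := by
      have : 0 < r i * (|a i| + |b i|) := (abs_nonneg _).trans_lt hi.2
      exact pos_of_mul_pos_right this (hr i).le
    have hlim : Tendsto (fun c : ℝ => c * (r i * (|a i| + |b i|))) (𝓝[>] 0) (𝓝 0) := by
      have : Continuous fun c : ℝ => c * (r i * (|a i| + |b i|)) := by fun_prop
      simpa using (this.tendsto 0).mono_left nhdsWithin_le_nhds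
    exact (hlim.eventually (eventually_lt_nhds (abs_pos.2 (h2 i hpos)))).mono fun c hc => hc.le
  obtain ⟨c, hc, hc0, hc1⟩ := (h3.and (Ioo_mem_nhdsGT (zero_lt_one (α := ℝ)))).exists
  refine ⟨c, hc0, fun i => ?_⟩
  by_cases hi : |a i + t * b i| < r i * (|a i| + |b i|)
  · exact hc i ⟨abs_le.1 hR, hi⟩
  · have : 0 ≤ r i * (|a i| + |b i|) := mul_nonneg (hr i).le (by positivity)
    exact (mul_le_of_le_one_left this hc1.le).trans (not_lt.1 hi)

lemma summable_pow_length {α : Type*} [Fintype α] {ρ : ℝ} (hρ : 0 ≤ ρ)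
    (h : Fintype.card α * ρ < 1) : Summable fun w : List α => ρ ^ w.length := by
  rw [← List.equivSigmaTuple.symm.summable_iff]
  refine (summable_sigma_of_nonneg fun _ => pow_nonneg hρ _).2
    ⟨fun n => Summable.of_finite, ?_⟩
  refine (summable_geometric_of_lt_one (by positivity) h).congr fun n => ?_
  simp [List.equivSigmaTuple, tsum_fintype, mul_pow]

/-! ### Almost every cocycle is nondegenerate -/

/-- The products `A_j A_w A_i`, with `w` a word of invertible matrices, are at least exponentially
small in the length of `w`. -/
def HasBlockBound (A : Fin k → Mat2) (sing : Finset (Fin k)) (i j : Fin k) (K : ℕ) : Prop :=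
  ∀ w : List (Fin k), (∀ b ∈ w, b ∉ sing) →
    1 ≤ Real.exp ((K : ℝ) * (w.length + 1)) * ‖A j * wordProd A w * A i‖

/-- All conditions of `IsNondegenerate` other than the bound for blocks hold for large `K` at every
cocycle of the manifold. -/
lemma exists_isNondegenerate {A : Fin k → Mat2} {sing : Finset (Fin k)}
    (hA : A ∈ cocycleManifold sing)
    (h : ∀ i ∈ sing, ∀ j ∈ sing, ∃ K, HasBlockBound A sing i j K) :
    ∃ K : ℕ, IsNondegenerate A sing K := by
  have hexp : ∀ c : ℝ, ∀ᶠ K : ℕ in atTop, c ≤ Real.exp K := fun c =>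
    (Real.tendsto_exp_atTop.comp tendsto_natCast_atTop_atTop).eventually_ge_atTop c
  have h1 : ∀ᶠ K : ℕ in atTop, ∀ b, ‖A b‖ ≤ Real.exp K := eventually_all.2 fun b => hexp _
  have h2 : ∀ᶠ K : ℕ in atTop, ∀ b, ‖(A b)⁻¹‖ ≤ Real.exp K := eventually_all.2 fun b => hexp _
  have h3 : ∀ᶠ K : ℕ in atTop, ∀ i j, i ∈ sing → j ∈ sing → HasBlockBound A sing i j K := by
    refine eventually_all.2 fun i => eventually_all.2 fun j => ?_
    by_cases hi : i ∈ sing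
    · by_cases hj : j ∈ sing
      · obtain ⟨K₀, hK₀⟩ := h i hi j hj
        filter_upwards [eventually_ge_atTop K₀] with K hK _ _ w hw
        refine (hK₀ w hw).trans ?_
        gcongr
      · exact Eventually.of_forall fun _ _ h' => absurd h' hj
    · exact Eventually.of_forall fun _ h' => absurd h' hi
  obtain ⟨K, h1, h2, h3⟩ := (h1.and (h2.and h3)).exists
  have hdet : ∀ b ∉ sing, IsUnit (A b).det := fun b hb => (hA.2 b hb).ne'.isUnit
  refine ⟨K, h1, fun b hb B => ?_, fun b hb B => ?_, fun b hb => ?_, fun i hi j hj => h3 i j hi hj⟩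
  · calc ‖B‖ = ‖B * A b * (A b)⁻¹‖ := by rw [Matrix.mul_nonsing_inv_cancel_right _ _ (hdet b hb)]
      _ ≤ ‖B * A b‖ * ‖(A b)⁻¹‖ := norm_mul_le _ _
      _ ≤ ‖B * A b‖ * Real.exp K := by gcongr; exact h2 b
      _ = _ := mul_comm _ _
  · calc ‖B‖ = ‖(A b)⁻¹ * (A b * B)‖ := by rw [Matrix.nonsing_inv_mul_cancel_left _ _ (hdet b hb)]
      _ ≤ ‖(A b)⁻¹‖ * ‖A b * B‖ := norm_mul_le _ _
      _ ≤ _ := by gcongr; exact h2 b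
  · obtain ⟨e, v, t, h⟩ := exists_eq_vecMulVec_of_det_eq_zero (rank_eq_one_iff.1 (hA.1 b hb)).1
    exact ⟨v, _, h⟩

lemma wordProd_congr {A A' : Fin k → Mat2} {w : List (Fin k)} (h : ∀ b ∈ w, A b = A' b) :
    wordProd A w = wordProd A' w := by
  induction w with
  | nil => rfl
  | cons b w ih => rw [wordProd, wordProd, ih fun c hc => h c (by simp [hc]), h b (by simp)]

lemma exists_pow_mul_norm_le {A : Fin k → Mat2} {sing : Finset (Fin k)}
    (hA : ∀ l ∉ sing, 0 < (A l).det) :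
    ∃ κ > 0, ∀ w : List (Fin k), (∀ b ∈ w, b ∉ sing) → ∀ y : Fin 2 → ℝ,
      κ ^ w.length * ‖y‖ ≤ ‖(wordProd A w).mulVec y‖ := by
  have h1 : ∀ᶠ κ : ℝ in 𝓝[>] 0, ∀ l, l ∉ sing → ∀ y : Fin 2 → ℝ, κ * ‖y‖ ≤ ‖(A l).mulVec y‖ := by
    refine eventually_all.2 fun l => ?_
    by_cases hl : l ∈ sing
    · exact Eventually.of_forall fun _ h => absurd hl h
    have hinj : Function.Injective (A l).mulVec := Matrix.mulVec_injective_iff_isUnit.2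
      ((Matrix.isUnit_iff_isUnit_det _).2 (hA l hl).ne'.isUnit)
    obtain ⟨C, hC0, hC⟩ := (A l).mulVecLin.exists_antilipschitzWith
      (LinearMap.ker_eq_bot.2 hinj)
    have hC0' : (0 : ℝ) < C := hC0
    filter_upwards [Ioo_mem_nhdsGT (inv_pos.2 hC0')] with κ hκ _ y
    have h2 : ‖y‖ ≤ C * ‖(A l).mulVec y‖ := by
      simpa using hC.le_mul_norm (map_zero _) y
    calc κ * ‖y‖ ≤ (C : ℝ)⁻¹ * ‖y‖ := by gcongr; exact hκ.2.le
      _ ≤ (C : ℝ)⁻¹ * (C * ‖(A l).mulVec y‖) := by gcongr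
      _ = _ := by field_simp
  obtain ⟨κ, hκ, hκ0⟩ := (h1.and self_mem_nhdsWithin).exists
  have hκ0' : 0 < κ := hκ0
  refine ⟨κ, hκ0', fun w => ?_⟩
  induction w with
  | nil => intro _ y; simp [wordProd]
  | cons b w ih =>
    intro hw y
    calc κ ^ (b :: w).length * ‖y‖ = κ ^ w.length * (κ * ‖y‖) := by
          rw [List.length_cons, pow_succ]; ring
      _ ≤ κ ^ w.length * ‖(A b).mulVec y‖ := by gcongr; exact hκ b (hw b (by simp)) y
      _ ≤ _ := by
          rw [wordProd, ← Matrix.mulVec_mulVec]; exact ih (by simp_all) _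

/-- The cocycles for which the blocks from `i` to `j` are not bounded below exponentially. -/
def badBlocks (sing : Finset (Fin k)) (i j : Fin k) : Set (Fin k → Mat2) :=
  {A | (∀ l, l ∉ sing → 0 < (A l).det) ∧ A i ≠ 0 ∧ A j ≠ 0 ∧ ¬ ∃ K, HasBlockBound A sing i j K}

/-- When only the parameter `t` of the row factor of `A_j` varies, the scalars by which the blocks
from `i` to `j` act are affine functions of `t`; their coefficients decay at most exponentially in
the length of the block, while the number of blocks of a given length grows exponentially. -/
lemma ae_update_notMem_badBlocks {sing : Finset (Fin k)} (e : Fin k → Bool) {i j : Fin k}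
    (hi : i ∈ sing) (hj : j ∈ sing) (x : ChartIndex sing → ℝ) :
    ∀ᵐ t : ℝ, chart e (Function.update x (Sum.inl (⟨j, hj⟩, 2)) t) ∉ badBlocks sing i j := by
  have hinv : ∀ t, ∀ l ∉ sing, chart e (Function.update x (Sum.inl (⟨j, hj⟩, 2)) t) l =
      chart e x l := fun t l hl => by
    simp [chart, hl]
  have hcol : ∀ t (l : sing), chartCol (Function.update x (Sum.inl (⟨j, hj⟩, 2)) t) l =
      chartCol x l := fun t l => by
    simp [chartCol]
  have hi' : ∀ t, ∃ u, chart e (Function.update x (Sum.inl (⟨j, hj⟩, 2)) t) i =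
      Matrix.vecMulVec (chartCol x ⟨i, hi⟩) u := fun t =>
    ⟨_, by rw [chart, dif_pos hi, hcol]⟩
  have hj' : ∀ t, chart e (Function.update x (Sum.inl (⟨j, hj⟩, 2)) t) j =
      Matrix.vecMulVec (chartCol x ⟨j, hj⟩) (chartRow (e j) t) := fun t => by
    rw [chart, dif_pos hj, hcol, Function.update_self]
  by_cases hdet : ∀ l, l ∉ sing → 0 < (chart e x l).det
  swap
  · exact Eventually.of_forall fun t h => hdet fun l hl => hinv t l hl ▸ h.1 l hl
  obtain ⟨κ, hκ0, hκ⟩ := exists_pow_mul_norm_le hdet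
  obtain ⟨p, q, hpq⟩ := exists_chartRow_dotProduct_eq (e j)
  set v := chartCol x ⟨i, hi⟩
  set v' := chartCol x ⟨j, hj⟩
  -- There are `k ^ n` words of length `n`, so these weights are summable.
  set ρ : ℝ := 1 / (k + 1) with hρ
  have hρ0 : 0 < ρ := by positivity
  have hsum : Summable fun w : List (Fin k) => ρ ^ w.length := by
    refine summable_pow_length hρ0.le ?_
    rw [Fintype.card_fin, hρ, mul_one_div, div_lt_one (by positivity)]
    linarith
  filter_upwards [ae_exists_le_abs_affine
    (fun w : List (Fin k) => (wordProd (chart e x) w).mulVec v p)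
    (fun w => (wordProd (chart e x) w).mulVec v q) _ (fun w => pow_pos hρ0 w.length) hsum]
    with t ⟨c, hc0, hc⟩
  rintro ⟨-, hAi, hAj, hno⟩
  obtain ⟨u, hu⟩ := hi' t
  rw [hu] at hAi
  rw [hj' t] at hAj
  simp only [ne_eq, Matrix.vecMulVec_eq_zero, not_or] at hAi hAj
  have hv : 0 < ‖v‖ := norm_pos_iff.2 hAi.1
  set d := ‖(Matrix.vecMulVec v' u : Mat2)‖ with hd
  have hd0 : 0 < d := norm_pos_iff.2 (by
    rw [ne_eq, Matrix.vecMulVec_eq_zero, not_or]; exact ⟨hAj.1, hAi.2⟩)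
  refine hno ?_
  have hexp : ∀ c : ℝ, ∀ᶠ K : ℕ in atTop, c ≤ Real.exp K := fun c =>
    (Real.tendsto_exp_atTop.comp tendsto_natCast_atTop_atTop).eventually_ge_atTop c
  obtain ⟨K, hK1, hK2⟩ := ((hexp (ρ * κ)⁻¹).and (hexp (c * ‖v‖ * d)⁻¹)).exists
  rw [inv_le_iff_one_le_mul₀ (by positivity)] at hK1 hK2
  refine ⟨K, fun w hw => ?_⟩
  rw [wordProd_congr fun b hb => hinv t b (hw b hb), hu, hj' t]
  set W := wordProd (chart e x) w with hW
  have hmul : (Matrix.vecMulVec v' (chartRow (e j) t) * W * Matrix.vecMulVec v u : Mat2) =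
      (chartRow (e j) t ⬝ᵥ W.mulVec v) • Matrix.vecMulVec v' u := by
    rw [mul_assoc, Matrix.mul_vecMulVec, Matrix.vecMulVec_mul_vecMulVec,
      Matrix.vecMulVec_smul]
  have hlow : ρ ^ w.length * κ ^ w.length * (c * ‖v‖ * d) ≤
      ‖(Matrix.vecMulVec v' (chartRow (e j) t) * W * Matrix.vecMulVec v u : Mat2)‖ := by
    rw [hmul, norm_smul, Real.norm_eq_abs, (hpq (W.mulVec v) t).1]
    calc ρ ^ w.length * κ ^ w.length * (c * ‖v‖ * d)
        = c * (ρ ^ w.length * (κ ^ w.length * ‖v‖)) * d := by ring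
      _ ≤ c * (ρ ^ w.length * (|W.mulVec v p| + |W.mulVec v q|)) * d := by
          gcongr
          exact (hκ w hw v).trans (hpq (W.mulVec v) t).2
      _ ≤ _ := by gcongr; exact hc w
  calc (1 : ℝ) ≤ (Real.exp K * (ρ * κ)) ^ w.length * (Real.exp K * (c * ‖v‖ * d)) :=
        one_le_mul_of_one_le_of_one_le (one_le_pow₀ hK1) hK2
    _ = Real.exp (K * (w.length + 1)) * (ρ ^ w.length * κ ^ w.length * (c * ‖v‖ * d)) := by
        rw [mul_add, mul_one, Real.exp_add, mul_comm (K : ℝ), Real.exp_nat_mul]; ring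
    _ ≤ _ := by gcongr

lemma continuous_wordProd (w : List (Fin k)) :
    Continuous fun A : Fin k → Mat2 => wordProd A w := by
  induction w with
  | nil => exact continuous_const
  | cons b w ih => exact ih.mul (continuous_apply b)

lemma continuous_det_apply (l : Fin k) : Continuous fun A : Fin k → Mat2 => (A l).det :=
  (continuous_apply l).matrix_det

lemma measurableSet_cocycleManifold (sing : Finset (Fin k)) :
    MeasurableSet (cocycleManifold sing) := by
  simp only [cocycleManifold, rank_eq_one_iff, ofPred_and, ofPred_forall]
  refine .inter (.iInter fun i => .iInter fun _ => .inter ?_ ?_)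
    (.iInter fun j => .iInter fun _ => ?_)
  · exact measurableSet_eq_fun (continuous_det_apply i).measurable measurable_const
  · exact (isOpen_ne_fun (continuous_apply i) continuous_const).measurableSet
  · exact measurableSet_lt measurable_const (continuous_det_apply j).measurable

lemma measurableSet_badBlocks (sing : Finset (Fin k)) (i j : Fin k) :
    MeasurableSet (badBlocks sing i j) := by
  simp only [badBlocks, HasBlockBound, ofPred_and, ofPred_forall]
  refine .inter (.iInter fun l => .iInter fun _ => ?_) (.inter ?_ (.inter ?_ ?_))
  · exact measurableSet_lt measurable_const (continuous_det_apply l).measurable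
  · exact (isOpen_ne_fun (continuous_apply i) continuous_const).measurableSet
  · exact (isOpen_ne_fun (continuous_apply j) continuous_const).measurableSet
  · refine MeasurableSet.compl (s := {A | ∃ K, HasBlockBound A sing i j K}) ?_
    simp only [HasBlockBound, ofPred_exists, ofPred_forall]
    refine .iUnion fun K => .iInter fun w => .iInter fun _ => ?_
    refine measurableSet_le measurable_const (Continuous.measurable ?_)
    exact continuous_const.mul
      (((continuous_apply j).mul (continuous_wordProd w)).mul (continuous_apply i)).norm

/-- Fubini's theorem in the parameter of the row factor of `A_j`. -/
lemma volume_chart_preimage_badBlocks {sing : Finset (Fin k)} (e : Fin k → Bool) {i j : Fin k}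
    (hi : i ∈ sing) (hj : j ∈ sing) :
    volume {x : ChartIndex sing → ℝ | chart e x ∈ badBlocks sing i j} = 0 := by
  set N := {x : ChartIndex sing → ℝ | chart e x ∈ badBlocks sing i j} with hN
  have hNm : MeasurableSet N :=
    (contDiff_chart e).continuous.measurable (measurableSet_badBlocks sing i j)
  have hf : Measurable (N.indicator fun _ => (1 : ℝ≥0∞)) := measurable_const.indicator hNm
  rw [← lintegral_indicator_one hNm, volume_pi]
  refine (lintegral_eq_of_lmarginal_eq (μ := fun _ => volume) {Sum.inl (⟨j, hj⟩, 2)} hf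
    (measurable_const (a := (0 : ℝ≥0∞))) ?_).trans lintegral_zero
  rw [lmarginal_singleton, lmarginal_singleton]
  ext1 x
  refine lintegral_congr_ae ?_
  filter_upwards [ae_update_notMem_badBlocks e hi hj x] with t ht
  exact indicator_of_notMem (s := N) (M := ℝ≥0∞) ht _

/-- Almost every cocycle is nondegenerate. -/
theorem ae_exists_isNondegenerate (sing : Finset (Fin k)) :
    ∀ᵐ A ∂(lebesgueCocycle sing), ∃ K : ℕ, IsNondegenerate A sing K := by
  have hbad : ∀ i ∈ sing, ∀ j ∈ sing, ∀ᵐ A ∂(lebesgueCocycle sing), A ∉ badBlocks sing i j := by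
    intro i hi j hj
    rw [lebesgueCocycle, ae_restrict_iff' (measurableSet_cocycleManifold sing)]
    refine measure_mono_null (t := ⋃ e, chart e '' {x : ChartIndex sing → ℝ |
      chart e x ∈ badBlocks sing i j}) (fun A hA => ?_) (measure_iUnion_null fun e => ?_)
    · simp only [mem_compl_iff, mem_ofPred_eq, Classical.not_imp, not_not] at hA
      obtain ⟨e, x, rfl⟩ := exists_chart_eq hA.1
      exact mem_iUnion.2 ⟨e, x, hA.2, rfl⟩
    · refine (contDiff_chart e).locallyLipschitz.hausdorffMeasure_image_eq_zero
        (Nat.cast_nonneg _) ?_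
      rw [← card_chartIndex, hausdorffMeasure_pi_real]
      exact volume_chart_preimage_badBlocks e hi hj
  have hmem : ∀ᵐ A ∂(lebesgueCocycle sing), A ∈ cocycleManifold sing :=
    ae_restrict_mem (measurableSet_cocycleManifold sing)
  have hbad' : ∀ᵐ A ∂(lebesgueCocycle sing), ∀ i j, i ∈ sing → j ∈ sing →
      A ∉ badBlocks sing i j := by
    refine ae_all_iff.2 fun i => ae_all_iff.2 fun j => ?_
    by_cases hi : i ∈ sing
    · by_cases hj : j ∈ sing
      · filter_upwards [hbad i hi j hj] with A hA _ _ using hA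
      · exact Eventually.of_forall fun _ _ h => absurd h hj
    · exact Eventually.of_forall fun _ h => absurd h hi
  filter_upwards [hmem, hbad'] with A hA hA'
  refine exists_isNondegenerate hA fun i hi j hj => ?_
  by_contra hno
  exact hA' i j hi hj ⟨hA.2, (rank_eq_one_iff.1 (hA.1 i hi)).2, (rank_eq_one_iff.1 (hA.1 j hj)).2,
    hno⟩

end RandomCocycle

end

theorem theorem1p1 {k : ℕ} (sing : Finset (Fin k)) (hsing : sing.Nonempty) (hinv : singᶜ.Nonempty)
    (μ : Measure (ℤ → Fin k))
    (hμ : RandomCocycle.IsBernoulliMeasure μ ∨ RandomCocycle.IsMixingMarkovMeasure μ) :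
    ∃ c : ℝ, 0 < c ∧
      ∀ᵐ A ∂(RandomCocycle.lebesgueCocycle sing),
        ∃ L : ℝ, RandomCocycle.IsFirstLyapunovExponent μ A (L : EReal) ∧
          ∃ C : ℝ, ∀ ε : ℝ, 0 < ε → ∀ n : ℕ, 1 ≤ n →
            μ (RandomCocycle.deviationEvent A L ε n) ≤
              ENNReal.ofReal (C * Real.exp (-(c * min 1 (ε ^ 2)) * (n : ℝ) ^ (1 / 3 : ℝ))) := by
  have hμ' : RandomCocycle.IsMixingMarkovMeasure μ :=
    hμ.elim RandomCocycle.IsBernoulliMeasure.isMixingMarkovMeasure id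
  refine ⟨1, one_pos, ?_⟩
  filter_upwards [RandomCocycle.ae_exists_isNondegenerate sing] with A ⟨K, hA⟩
  simpa only [one_mul] using hA.exists_lyapunov (Nat.cast_nonneg K) hsing hμ'
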